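/- Let $\mathcal X\subset\mathbb R^d$ be compact, let $\mathcal H_K$ be the RKHS, with norm $\|\cdot\|$, of a continuous, symmetric, positive semidefinite kernel $K:\mathcal X\times\mathcal X\to\mathbb R$ with $\sup_{x}K(x,x)\le 1$, and let $\rho$ be a probability measure on $\mathcal X\times[-Y,Y]$, $Y<\infty$, whose marginal $\rho_{\mathcal X}$ on $\mathcal X$ has support $\mathcal X$. Write $\mathcal R(f)=\int (f(x)-y)^2\,d\rho$ and $f_\rho(x)=\int y\,d\rho(y|x)$. Let $L_K$ be the integral operator $(L_Kf)(x)=\int K(x,x')f(x')\,d\rho_{\mathcal X}(x')$ on $L^2_{\rho_{\mathcal X}}$, and for $b\ge 0$ let $\operatorname{Tr}[L_K^b]$ be the sum of $\nu^b$ over the positive eigenvalues $\nu$ of $L_K$, counted with multiplicity (so $\operatorname{Tr}[L_K^0]$ is the rank of $L_K$). Assume that $f_\rho=L_K^\beta g$ for some $g\in L^2_{\rho_{\mathcal X}}$, where $0<\beta\le\frac12$, and that $\operatorname{Tr}[L_K^b]<\infty$ for some $b\in[0,1]$. Given $n\ge 1$ i.i.d. samples $S=((x_i,y_i))_{i=1}^n$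 from $\rho$ and $\lambda\ge 0$, the algorithm KTR$^3$ permutes $S$ uniformly at random, draws $k$ uniformly from $\{0,\dots,n-1\}$, computes $f_k=\arg\min_{f\in\mathcal H_K}\lambda\|f\|^2+\frac1n\sum_{i=1}^k(f(x_i)-y_i)^2$ (the minimizer of minimum norm, if it is not unique) and returns $f_{S,\lambda}=T^Y\circ f_k$, where $T^Y(z)=\min(Y,|z|)\operatorname{sign}(z)$. Below, $\mathbb E$ is the expectation over $S$ and over the randomization of the algorithm. (i) For all $\beta\in(0,\frac12]$, $b\in(0,1]$, $Y$, $T$, $G$ there are a constant $C$ and a choice of $\lambda=\lambda(n,\mathcal R(f_\rho))\ge 0$, both depending otherwise only on $\beta,b,Y,T,G$, such that for every problem as above with $\operatorname{Tr}[L_K^b]\le T$ and $f_\rho=L_K^\beta g$ for some $\|g\|_{L^2_{\rho_{\mathcal X}}}\le G$, and for every $n\ge1$, $$\mathbb E[\mathcal R(f_{S,\lambda})]-\mathcal R(f_\rho)\le C\min\left(\left(\frac{\mathcal R(f_\rho)}{n}\right)^{\frac{2\beta}{2\beta+1}}+n^{-2\beta},\; n^{-\frac{2\beta}{2\beta+b}}\right).$$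 (ii) (The case $b=0$, $\beta=\frac12$.) For all $Y$, $G$ there are a constant $C$ and a choice of $\lambda=\lambda(n)\ge0$, both depending otherwise only on $Y,G$, such that for every problem as above with $\operatorname{Tr}[L_K^0]<\infty$ and $f_\rho=L_K^{1/2}g$ for some $\|g\|_{L^2_{\rho_{\mathcal X}}}\le G$, and for every $n\ge1$, $$\mathbb E[\mathcal R(f_{S,\lambda})]-\mathcal R(f_\rho)\le C\,\frac{\operatorname{Tr}[L_K^0]}{n}\log\left(1+\frac{n}{\operatorname{Tr}[L_K^0]}\right),$$ where the right-hand side is read as $0$ if $\operatorname{Tr}[L_K^0]=0$. -/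

import Mathlib

open MeasureTheory
open scoped ENNReal

universe u

noncomputable section

namespace KTR3

/-! ### Least squares regression -/

section Regression

variable {X : Type*} [MeasurableSpace X]

/-- The risk of `f` with respect to the square loss under the distribution `ρ`. -/
def risk (ρ : Measure (X × ℝ)) (f : X → ℝ) : ℝ :=
  ∫ p, (f p.1 - p.2) ^ 2 ∂ρ

/-- The regression function `f_ρ(x) = ∫ y dρ(y | x)`, the mean of the label conditionally on `x`. -/
def regressionFunction (ρ : Measure (X × ℝ)) [IsFiniteMeasure ρ] (x : X) : ℝ :=
  ∫ y, y ∂(ρ.condKernel x)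

/-- The Bayes risk `R(f_ρ)`. -/
def bayesRisk (ρ : Measure (X × ℝ)) [IsFiniteMeasure ρ] : ℝ :=
  risk ρ (regressionFunction ρ)

end Regression

/-! ### The integral operator, its fractional powers and their traces -/

section IntegralOperator

variable {X : Type*} [TopologicalSpace X] [CompactSpace X] [MeasurableSpace X] [BorelSpace X]

/-- The kernel section `K(x, ·)`, as an element of `L²(μ)`, depends continuously on `x`. -/
def kernelSection (K : C(X × X, ℝ)) (μ : Measure X) [IsFiniteMeasure μ] : C(X, Lp ℝ 2 μ) :=
  ((ContinuousMap.toLp (E := ℝ) 2 μ ℝ : C(X, ℝ) →L[ℝ] Lp ℝ 2 μ) : C(C(X, ℝ), Lp ℝ 2 μ)).comp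
    K.curry

theorem inner_kernelSection (K : C(X × X, ℝ)) (μ : Measure X) [IsFiniteMeasure μ]
    (f : Lp ℝ 2 μ) (x : X) :
    inner ℝ (kernelSection K μ x) f = ∫ x', K (x, x') * f x' ∂μ := by
  rw [MeasureTheory.L2.inner_def]
  refine integral_congr_ae ?_
  filter_upwards [ContinuousMap.coeFn_toLp (p := 2) (𝕜 := ℝ) μ (K.curry x)] with x' hx'
  have h : (kernelSection K μ x : X → ℝ) x' = K (x, x') := by
    simpa [kernelSection] using hx'
  simp [h, mul_comm]

/-- The function `x ↦ ∫ K(x, x') f(x') dμ(x')`, which is continuous. -/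
def integralFunction (K : C(X × X, ℝ)) (μ : Measure X) [IsFiniteMeasure μ] (f : Lp ℝ 2 μ) :
    C(X, ℝ) where
  toFun x := ∫ x', K (x, x') * f x' ∂μ
  continuous_toFun := by
    simp_rw [← inner_kernelSection]
    exact (kernelSection K μ).continuous.inner continuous_const

/-- The integral operator `L_K : L²(μ) → L²(μ)`, `(L_K f)(x) = ∫ K(x, x') f(x') dμ(x')`. -/
def integralOperator (K : C(X × X, ℝ)) (μ : Measure X) [IsFiniteMeasure μ] :
    Lp ℝ 2 μ →L[ℝ] Lp ℝ 2 μ :=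
  (ContinuousMap.toLp (E := ℝ) 2 μ ℝ).comp
    (LinearMap.mkContinuous
      ({ toFun := integralFunction K μ
         map_add' := fun f g => by
          ext x
          change ∫ x', K (x, x') * (f + g : Lp ℝ 2 μ) x' ∂μ =
            (∫ x', K (x, x') * f x' ∂μ) + ∫ x', K (x, x') * g x' ∂μ
          simp only [← inner_kernelSection, inner_add_right]
         map_smul' := fun c f => by
          ext x
          change ∫ x', K (x, x') * (c • f : Lp ℝ 2 μ) x' ∂μ =
            c * ∫ x', K (x, x') * f x' ∂μ
          simp only [← inner_kernelSection, inner_smul_right] } : Lp ℝ 2 μ →ₗ[ℝ] C(X, ℝ))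
      ‖kernelSection K μ‖
      (fun f => by
        refine (ContinuousMap.norm_le _ (by positivity)).2 fun x => ?_
        have h : (integralFunction K μ f) x = inner ℝ (kernelSection K μ x) f :=
          (inner_kernelSection K μ f x).symm
        refine (congrArg norm h).le.trans ((norm_inner_le_norm _ _).trans ?_)
        gcongr
        exact ContinuousMap.norm_coe_le_norm _ x))

theorem integralOperator_ae_eq (K : C(X × X, ℝ)) (μ : Measure X) [IsFiniteMeasure μ]
    (f : Lp ℝ 2 μ) :
    integralOperator K μ f =ᵐ[μ] fun x => ∫ x', K (x, x') * f x' ∂μ :=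
  ContinuousMap.coeFn_toLp (p := 2) (𝕜 := ℝ) μ (integralFunction K μ f)

end IntegralOperator

section Powers

variable {E : Type*} [NormedAddCommGroup E] [InnerProductSpace ℝ E] [CompleteSpace E]

/-- For a positive compact self-adjoint operator `L` and `b ≥ 0`, the trace of `L ^ b`: the sum of
`ν ^ b` over the positive eigenvalues `ν` of `L`, counted with multiplicity. For `b = 0` this is
the number of positive eigenvalues, that is, the rank of `L`. -/
def tracePow (L : E →L[ℝ] E) (b : ℝ) : ℝ≥0∞ :=
  ∑' ν : Set.Ioi (0 : ℝ),
    ((Module.rank ℝ (Module.End.eigenspace (L : E →ₗ[ℝ] E) (ν : ℝ))).toENat : ℝ≥0∞) *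
      ENNReal.ofReal ((ν : ℝ) ^ b)

/-- For a positive compact self-adjoint operator `L` and `β > 0`, the relation `f = L ^ β g`, where
`L ^ β g` is the sum of `ν ^ β` times the orthogonal projection of `g` on the eigenspace of `ν`,
over the positive eigenvalues `ν` of `L`. (If `ν > 0` is not an eigenvalue, its eigenspace is zero
and it does not contribute.) -/
def IsPowApply (L : E →L[ℝ] E) (β : ℝ) (g f : E) : Prop :=
  HasSum (fun ν : Set.Ioi (0 : ℝ) =>
    ((ν : ℝ) ^ β) •
      (Module.End.eigenspace (L : E →ₗ[ℝ] E) (ν : ℝ)).starProjection g) f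

end Powers

/-- The source condition with constant `G`: the regression function is `L_K ^ β g` for
some `g ∈ L²(ρ_X)` with `‖g‖_ρ ≤ G`; in other words `‖L_K ^ (-β) f_ρ‖_ρ ≤ G`. -/
def SourceCondition {X : Type*} [TopologicalSpace X] [CompactSpace X] [MeasurableSpace X]
    [BorelSpace X] (K : C(X × X, ℝ)) (ρ : Measure (X × ℝ))
    [IsFiniteMeasure ρ] (β G : ℝ) : Prop :=
  ∃ f g : Lp ℝ 2 ρ.fst, f =ᵐ[ρ.fst] regressionFunction ρ ∧ ‖g‖ ≤ G ∧
    IsPowApply (integralOperator K ρ.fst) β g f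

/-! ### The algorithm -/

section Algorithm

variable {X : Type*} {H : Type*} [NormedAddCommGroup H] [InnerProductSpace ℝ H] [RKHS ℝ H X ℝ]

/-- The regularized empirical risk `λ ‖f‖² + (1/n) ∑_{i ≤ k} (f(x_i) - y_i)²` on the first `k`
samples of the training set `S` of size `n` (samples are numbered from `0` here). -/
def objective (lam : ℝ) {n : ℕ} (S : Fin n → X × ℝ) (k : Fin n) (f : H) : ℝ :=
  lam * ‖f‖ ^ 2 + (1 / (n : ℝ)) * ∑ i with i < k, (f (S i).1 - (S i).2) ^ 2

/-- `f` minimizes the regularized empirical risk over `H`, and it has minimum norm among all the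
minimizers. -/
def IsRidgeSolution (lam : ℝ) {n : ℕ} (S : Fin n → X × ℝ) (k : Fin n) (f : H) : Prop :=
  (∀ g : H, objective lam S k f ≤ objective lam S k g) ∧
    ∀ h : H, (∀ g : H, objective lam S k h ≤ objective lam S k g) → ‖f‖ ≤ ‖h‖

variable (H) in
/-- The candidate function `f_k`, the minimum norm minimizer of the regularized empirical risk on
the first `k` samples. It exists and is unique for every `λ ≥ 0`. -/
def ridge (lam : ℝ) {n : ℕ} (S : Fin n → X × ℝ) (k : Fin n) : H :=
  Classical.epsilon fun f : H => IsRidgeSolution lam S k f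

/-- The truncation function `T^Y(z) = min(Y, |z|) sign(z)`. -/
def truncate (Y z : ℝ) : ℝ := min Y |z| * Real.sign z

variable (H) in
/-- The risk of the function returned by kernel truncated randomized ridge regression on the
training set `S`, averaged over the randomization of the algorithm: a uniformly random permutation
of `S` and a uniformly random index `k ∈ {0, …, n - 1}`. -/
def averageRisk [MeasurableSpace X] (ρ : Measure (X × ℝ)) (Y lam : ℝ) {n : ℕ}
    (S : Fin n → X × ℝ) : ℝ :=
  (1 / (n.factorial : ℝ)) * ∑ σ : Equiv.Perm (Fin n), (1 / (n : ℝ)) * ∑ k : Fin n,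
    risk ρ fun x => truncate Y (ridge H lam (S ∘ σ) k x)

variable (H) in
/-- The excess risk of kernel truncated randomized ridge regression, where the expectation is over
the `n` independent samples and over the randomization of the algorithm, is at most `B`. Finiteness
of the expectation is part of the claim. -/
def ExcessRiskLE [MeasurableSpace X] (ρ : Measure (X × ℝ)) [IsFiniteMeasure ρ] (Y lam : ℝ) (n : ℕ)
    (B : ℝ) : Prop :=
  Integrable (fun S : Fin n → X × ℝ => averageRisk H ρ Y lam S) (Measure.pi fun _ => ρ) ∧
    (∫ S, averageRisk H ρ Y lam S ∂(Measure.pi fun _ : Fin n => ρ)) - bayesRisk ρ ≤ B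

end Algorithm

/-! ### Standing assumptions -/

/-- `K` is the (continuous) reproducing kernel of `H`, it is bounded by `1` on the diagonal, the
labels are bounded by `Y`, and the marginal of `ρ` on `X` has full support. A reproducing kernel is
automatically symmetric and positive semidefinite. -/
structure Setting {X : Type*} [TopologicalSpace X] [MeasurableSpace X]
    (K : C(X × X, ℝ)) (H : Type*) [NormedAddCommGroup H] [InnerProductSpace ℝ H] [CompleteSpace H]
    [RKHS ℝ H X ℝ] (ρ : Measure (X × ℝ)) (Y : ℝ) : Prop where
  kernel_eq : ∀ x x' : X, RKHS.kernel H x x' 1 = K (x, x')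
  kernel_le_one : ∀ x : X, K (x, x) ≤ 1
  label_bounded : ∀ᵐ p ∂ρ, |p.2| ≤ Y
  support_eq : ρ.fst.support = Set.univ

end KTR3

end

/-! The candidate f_k depends only on the samples before the k-th, so its expected risk is its
expected loss on the fresh sample k. Permutations preserve the product measure, so the expected risk
of the algorithm is 1/n times the expected cumulative loss of sequential ridge regression
(`integral_averageRisk`).

Put μ = λn, number the samples from 1, and let h_t be the ridge leverage score of x_t among the
first t points, itself included. Adding sample t raises the minimum of the regularized empirical
risk by exactly (f(x_t) - y_t)² (1 - h_t), f being the preceding solution, so these terms sum to at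
most the objective at any competitor (`sum_sq_mul_le_regRisk`). The factor 1 - h_t is removed in two
ways. Either h_t ≤ 1/(1 + μ) is used, at the price of a factor 1 + 1/μ; this yields the rate in the
Bayes risk. Or the truncated loss is bounded by 4Y², at the price of 4Y² Σ h_t. By exchangeability E
h_t is 1/t times the expected trace of Id - μA⁻¹, with A the regularized Gram operator of t points;
in an eigenbasis of the covariance operator, Jensen's inequality bounds E h_t by Σ ν_i/(tν_i + μ),
the ν_i being the positive eigenvalues of L_K (`lintegral_leverage_le`).

The expected objective at u, divided by n, is λ‖u‖² + ‖u - f_ρ‖² + R(f_ρ), and under the source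
condition the infimum over u of the first two terms is at most λ^(2β)‖g‖²
(`le_of_forall_penalized`). Summed over t, the leverage bound is at most n^b μ^(-b) T/b, or m log(1
+ n/m) when the rank is m and μ = 1. It remains to balance λ. -/

namespace KTR3

open scoped InnerProductSpace

/-! ### Regularized Gram operators, leverage scores, sequential ridge regression -/

section RegularizedGram

variable {H : Type*} [NormedAddCommGroup H] [InnerProductSpace ℝ H] {ι : Type*}

/-- The operator `μ + ∑ i ∈ s, k i ⊗ k i`. -/
noncomputable def regOp (μ : ℝ) (s : Finset ι) (k : ι → H) : H →L[ℝ] H :=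
  μ • ContinuousLinearMap.id ℝ H + ∑ i ∈ s, (innerSL ℝ (k i)).smulRight (k i)

theorem regOp_apply (μ : ℝ) (s : Finset ι) (k : ι → H) (f : H) :
    regOp μ s k f = μ • f + ∑ i ∈ s, ⟪k i, f⟫_ℝ • k i := by
  simp [regOp]

theorem inner_regOp (μ : ℝ) (s : Finset ι) (k : ι → H) (f g : H) :
    ⟪f, regOp μ s k g⟫_ℝ = μ * ⟪f, g⟫_ℝ + ∑ i ∈ s, ⟪k i, f⟫_ℝ * ⟪k i, g⟫_ℝ := by
  rw [regOp_apply, inner_add_right, inner_smul_right, inner_sum]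
  congr 1
  refine Finset.sum_congr rfl fun i _ => ?_
  rw [inner_smul_right, real_inner_comm f, mul_comm]

theorem inner_regOp_comm (μ : ℝ) (s : Finset ι) (k : ι → H) (f g : H) :
    ⟪regOp μ s k f, g⟫_ℝ = ⟪f, regOp μ s k g⟫_ℝ := by
  rw [real_inner_comm, inner_regOp, inner_regOp, real_inner_comm]
  simp only [mul_comm]

theorem inner_regOp_self (μ : ℝ) (s : Finset ι) (k : ι → H) (f : H) :
    ⟪f, regOp μ s k f⟫_ℝ = μ * ‖f‖ ^ 2 + ∑ i ∈ s, ⟪k i, f⟫_ℝ ^ 2 := by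
  rw [inner_regOp, real_inner_self_eq_norm_sq]
  simp only [sq]

theorem mul_norm_sq_le_inner_regOp (μ : ℝ) (s : Finset ι) (k : ι → H) (f : H) :
    μ * ‖f‖ ^ 2 ≤ ⟪f, regOp μ s k f⟫_ℝ := by
  rw [inner_regOp_self]
  exact le_add_of_nonneg_right (Finset.sum_nonneg fun i _ => sq_nonneg _)

theorem inner_regOp_nonneg {μ : ℝ} (hμ : 0 < μ) (s : Finset ι) (k : ι → H) (f : H) :
    0 ≤ ⟪f, regOp μ s k f⟫_ℝ :=
  le_trans (by positivity) (mul_norm_sq_le_inner_regOp μ s k f)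

theorem regOp_insert [DecidableEq ι] (μ : ℝ) {s : Finset ι} {j : ι} (hj : j ∉ s) (k : ι → H)
    (f : H) : regOp μ (insert j s) k f = regOp μ s k f + ⟪k j, f⟫_ℝ • k j := by
  rw [regOp_apply, regOp_apply, Finset.sum_insert hj]
  abel

variable [CompleteSpace H]

/-- Lax–Milgram: the form of `regOp` is coercive with constant μ. Hence `Ring.inverse` below is a
genuine inverse. -/
theorem isUnit_regOp {μ : ℝ} (hμ : 0 < μ) (s : Finset ι) (k : ι → H) :
    IsUnit (regOp μ s k) := by
  have hc : IsCoercive ((innerSL ℝ).comp (regOp μ s k)) := by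
    refine ⟨μ, hμ, fun f => ?_⟩
    have := mul_norm_sq_le_inner_regOp μ s k f
    rw [← inner_regOp_comm] at this
    simpa [sq, mul_assoc] using this
  have he : (hc.continuousLinearEquivOfBilin : H →L[ℝ] H) = regOp μ s k := by
    ext f
    refine ext_inner_right ℝ fun g => ?_
    simp
  rw [← he]
  exact (ContinuousLinearEquiv.toUnit hc.continuousLinearEquivOfBilin).isUnit

theorem regOp_inverse {μ : ℝ} (hμ : 0 < μ) (s : Finset ι) (k : ι → H) (f : H) :
    regOp μ s k (Ring.inverse (regOp μ s k) f) = f :=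
  congrArg (fun A : H →L[ℝ] H => A f) (Ring.mul_inverse_cancel _ (isUnit_regOp hμ s k))

theorem inverse_regOp {μ : ℝ} (hμ : 0 < μ) (s : Finset ι) (k : ι → H) (f : H) :
    Ring.inverse (regOp μ s k) (regOp μ s k f) = f :=
  congrArg (fun A : H →L[ℝ] H => A f) (Ring.inverse_mul_cancel _ (isUnit_regOp hμ s k))

/-- The ridge leverage score of `k j` relative to the family `k` on `s`. -/
noncomputable def leverage (μ : ℝ) (s : Finset ι) (k : ι → H) (j : ι) : ℝ :=
  ⟪k j, Ring.inverse (regOp μ s k) (k j)⟫_ℝ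

theorem leverage_nonneg {μ : ℝ} (hμ : 0 < μ) (s : Finset ι) (k : ι → H) (j : ι) :
    0 ≤ leverage μ s k j := by
  have h := inner_regOp_nonneg hμ s k (Ring.inverse (regOp μ s k) (k j))
  rwa [regOp_inverse hμ, real_inner_comm] at h

/-- Write A for `regOp μ s k`, x = A⁻¹ k_j and h = ⟨k_j, x⟩. Then h = ⟨x, Ax⟩ = μ‖x‖² + Σ ⟨k_i, x⟩²,
where ‖x‖ ≥ h because ‖k_j‖ ≤ 1 and the term i = j is h². So h ≥ (1 + μ)h². -/
theorem leverage_mul_le {μ : ℝ} (hμ : 0 < μ) {s : Finset ι} {k : ι → H} {j : ι}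
    (hj : j ∈ s) (hk : ‖k j‖ ≤ 1) : leverage μ s k j * (1 + μ) ≤ 1 := by
  set x := Ring.inverse (regOp μ s k) (k j) with hx
  have h0 := leverage_nonneg hμ s k j
  have h1 : leverage μ s k j = μ * ‖x‖ ^ 2 + ∑ i ∈ s, ⟪k i, x⟫_ℝ ^ 2 := by
    rw [← inner_regOp_self, hx, regOp_inverse hμ, real_inner_comm]
    rfl
  have h2 : leverage μ s k j ^ 2 ≤ ∑ i ∈ s, ⟪k i, x⟫_ℝ ^ 2 :=
    Finset.single_le_sum (f := fun i => ⟪k i, x⟫_ℝ ^ 2) (fun i _ => sq_nonneg _) hj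
  have h3 : leverage μ s k j ≤ ‖x‖ :=
    (real_inner_le_norm _ _).trans (mul_le_of_le_one_left (norm_nonneg _) hk)
  have h4 : leverage μ s k j ^ 2 ≤ ‖x‖ ^ 2 := by gcongr
  rcases h0.eq_or_lt with h | h
  · rw [← h]; simp
  · have : leverage μ s k j * (leverage μ s k j * (1 + μ)) ≤ leverage μ s k j * 1 := by
      nlinarith
    exact le_of_mul_le_mul_left this h

theorem leverage_le_one {μ : ℝ} (hμ : 0 < μ) {s : Finset ι} {k : ι → H} {j : ι}
    (hj : j ∈ s) (hk : ‖k j‖ ≤ 1) : leverage μ s k j ≤ 1 := by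
  nlinarith [leverage_mul_le hμ hj hk, leverage_nonneg hμ s k j]

/-- The least squares objective with squared norm penalty of weight `μ` on the data indexed by
`s`. -/
noncomputable def regRisk (μ : ℝ) (s : Finset ι) (k : ι → H) (y : ι → ℝ) (f : H) : ℝ :=
  μ * ‖f‖ ^ 2 + ∑ i ∈ s, (⟪k i, f⟫_ℝ - y i) ^ 2

/-- The minimizer of `regRisk`. -/
noncomputable def regSol (μ : ℝ) (s : Finset ι) (k : ι → H) (y : ι → ℝ) : H :=
  Ring.inverse (regOp μ s k) (∑ i ∈ s, y i • k i)

/-- Completion of the square around the solution of the normal equations. -/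
theorem regRisk_eq {μ : ℝ} (hμ : 0 < μ) (s : Finset ι) (k : ι → H) (y : ι → ℝ) (f : H) :
    regRisk μ s k y f = regRisk μ s k y (regSol μ s k y) +
      ⟪f - regSol μ s k y, regOp μ s k (f - regSol μ s k y)⟫_ℝ := by
  have key : ∀ g : H, regRisk μ s k y g =
      ⟪g, regOp μ s k g⟫_ℝ - 2 * ⟪g, ∑ i ∈ s, y i • k i⟫_ℝ + ∑ i ∈ s, y i ^ 2 := by
    intro g
    rw [regRisk, inner_regOp_self, inner_sum, Finset.mul_sum, add_sub_assoc, add_assoc,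
      ← Finset.sum_sub_distrib, ← Finset.sum_add_distrib]
    congr 1
    refine Finset.sum_congr rfl fun i _ => ?_
    rw [inner_smul_right, real_inner_comm]
    ring
  have hb : regOp μ s k (regSol μ s k y) = ∑ i ∈ s, y i • k i := regOp_inverse hμ s k _
  rw [key, key, ← hb, map_sub, inner_sub_left, inner_sub_right, inner_sub_right,
    ← inner_regOp_comm μ s k (regSol μ s k y) f, real_inner_comm f]
  ring

theorem regRisk_regSol_le {μ : ℝ} (hμ : 0 < μ) (s : Finset ι) (k : ι → H) (y : ι → ℝ) (f : H) :
    regRisk μ s k y (regSol μ s k y) ≤ regRisk μ s k y f := by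
  rw [regRisk_eq hμ s k y f]
  exact le_add_of_nonneg_right (inner_regOp_nonneg hμ s k _)

theorem eq_regSol_of_regRisk_le {μ : ℝ} (hμ : 0 < μ) (s : Finset ι) (k : ι → H) (y : ι → ℝ)
    {f : H} (hf : regRisk μ s k y f ≤ regRisk μ s k y (regSol μ s k y)) :
    f = regSol μ s k y := by
  rw [regRisk_eq hμ s k y f] at hf
  have h := mul_norm_sq_le_inner_regOp μ s k (f - regSol μ s k y)
  have h2 : ‖f - regSol μ s k y‖ ^ 2 ≤ 0 := by
    by_contra hc
    have := mul_pos hμ (not_le.1 hc)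
    linarith
  rw [← sub_eq_zero, ← norm_eq_zero]
  exact pow_eq_zero_iff two_ne_zero |>.1 (le_antisymm h2 (sq_nonneg _))

/-- With A' the enlarged operator, A'(old solution - new solution) = e k_j. The enlarged objective
at the old solution is the old minimum plus e²; by completion of the square it is also the new
minimum plus e² times the leverage. -/
theorem regRisk_insert_regSol [DecidableEq ι] {μ : ℝ} (hμ : 0 < μ) {s : Finset ι} {j : ι}
    (hj : j ∉ s) (k : ι → H) (y : ι → ℝ) :
    regRisk μ (insert j s) k y (regSol μ (insert j s) k y) =
      regRisk μ s k y (regSol μ s k y) +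
        (⟪k j, regSol μ s k y⟫_ℝ - y j) ^ 2 * (1 - leverage μ (insert j s) k j) := by
  set e := ⟪k j, regSol μ s k y⟫_ℝ - y j with he
  have h1 : regOp μ (insert j s) k (regSol μ s k y - regSol μ (insert j s) k y) = e • k j := by
    rw [map_sub, regOp_insert μ hj, regSol, regOp_inverse hμ, regSol, regOp_inverse hμ,
      Finset.sum_insert hj, ← regSol, he, sub_smul]
    abel
  have h2 : regSol μ s k y - regSol μ (insert j s) k y =
      e • Ring.inverse (regOp μ (insert j s) k) (k j) := by
    rw [← map_smul, ← h1, inverse_regOp hμ]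
  have h3 := regRisk_eq hμ (insert j s) k y (regSol μ s k y)
  have h4 : regRisk μ (insert j s) k y (regSol μ s k y) =
      regRisk μ s k y (regSol μ s k y) + e ^ 2 := by
    rw [regRisk, regRisk, Finset.sum_insert hj]
    ring
  rw [h1, h2, inner_smul_left, inner_smul_right, real_inner_comm, h4] at h3
  have h5 : leverage μ (insert j s) k j =
      ⟪k j, Ring.inverse (regOp μ (insert j s) k) (k j)⟫_ℝ := rfl
  rw [← h5] at h3
  simp only [conj_trivial] at h3
  linarith

/-- The sequential prediction identity for ridge regression, as an inequality. -/
theorem sum_sq_mul_le_regRisk {n : ℕ} {μ : ℝ} (hμ : 0 < μ) (k : Fin n → H) (y : Fin n → ℝ)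
    (f : H) :
    ∑ t, (⟪k t, regSol μ (Finset.Iio t) k y⟫_ℝ - y t) ^ 2 *
        (1 - leverage μ (Finset.Iic t) k t) ≤
      regRisk μ Finset.univ k y f := by
  -- The exact increments of the minimum telescope over prefixes of the sample.
  have key : ∀ m : ℕ, m ≤ n → ∑ t with (t : Fin n).val < m,
      (⟪k t, regSol μ (Finset.Iio t) k y⟫_ℝ - y t) ^ 2 * (1 - leverage μ (Finset.Iic t) k t) ≤
      regRisk μ {t : Fin n | t.val < m} k y (regSol μ {t : Fin n | t.val < m} k y) := by
    intro m
    induction m with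
    | zero =>
      intro _
      simp only [not_lt_zero, Finset.filter_false, Finset.sum_empty, regRisk]
      positivity
    | succ m ih =>
      intro hm
      let j : Fin n := ⟨m, hm⟩
      have hs : ({t : Fin n | t.val < m + 1} : Finset (Fin n)) =
          insert j ({t : Fin n | t.val < m} : Finset (Fin n)) := by
        ext t
        simp only [Finset.mem_filter, Finset.mem_univ, true_and, Finset.mem_insert, Fin.ext_iff, j]
        omega
      have hj : j ∉ ({t : Fin n | t.val < m} : Finset (Fin n)) := by simp [j]
      have h1 : Finset.Iio j = ({t : Fin n | t.val < m} : Finset (Fin n)) := by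
        ext t; simp [j, Fin.lt_def]
      have h2 : Finset.Iic j = insert j ({t : Fin n | t.val < m} : Finset (Fin n)) := by
        rw [← hs]; ext t; simp [j, Fin.le_def]
      rw [hs, Finset.sum_insert hj, regRisk_insert_regSol hμ hj, h1, h2, add_comm]
      gcongr
      exact ih (by omega)
  have h := key n le_rfl
  simp only [Fin.is_lt, Finset.filter_true] at h
  exact h.trans (regRisk_regSol_le hμ _ k y f)

/-- For a unit vector, ⟨u, A⁻¹u⟩ ≥ 1/⟨u, Au⟩, and here ⟨u, Au⟩ = x + μ. This follows by expanding
⟨v, Av⟩ ≥ 0 at v = A⁻¹u - (x + μ)⁻¹u. -/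
theorem one_sub_mul_inner_inverse_regOp_le {μ : ℝ} (hμ : 0 < μ) (s : Finset ι) (k : ι → H)
    {u : H} (hu : ‖u‖ = 1) :
    1 - μ * ⟪u, Ring.inverse (regOp μ s k) u⟫_ℝ ≤
      (∑ j ∈ s, ⟪k j, u⟫_ℝ ^ 2) / ((∑ j ∈ s, ⟪k j, u⟫_ℝ ^ 2) + μ) := by
  set x := ∑ j ∈ s, ⟪k j, u⟫_ℝ ^ 2 with hx
  have hx0 : 0 ≤ x := Finset.sum_nonneg fun i _ => sq_nonneg _
  have hxp : 0 < x + μ := by positivity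
  set w := Ring.inverse (regOp μ s k) u with hw
  have hAw : regOp μ s k w = u := regOp_inverse hμ s k u
  have h := inner_regOp_nonneg hμ s k (w - (x + μ)⁻¹ • u)
  rw [map_sub, map_smul, inner_sub_left, inner_sub_right, inner_sub_right, inner_smul_left,
    inner_smul_left, inner_smul_right, inner_smul_right, ← inner_regOp_comm μ s k w u, hAw,
    inner_regOp_self, real_inner_self_eq_norm_sq, hu, real_inner_comm u w, ← hx] at h
  simp only [conj_trivial] at h
  have h2 : (x + μ)⁻¹ * ((x + μ)⁻¹ * (μ * 1 ^ 2 + x)) = (x + μ)⁻¹ := by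
    field_simp
    ring
  have h3 : x / (x + μ) = 1 - μ * (x + μ)⁻¹ := by
    field_simp
    ring
  rw [h3]
  have h4 : (x + μ)⁻¹ ≤ ⟪u, w⟫_ℝ := by nlinarith
  nlinarith

/-- The leverage scores add up to the trace of A⁻¹ Σ k_j ⊗ k_j = Id - μA⁻¹, whose diagonal entries
in the basis `b` are bounded by the preceding lemma. -/
theorem sum_leverage_le {κ : Type*} (b : HilbertBasis κ ℝ H) {μ : ℝ} (hμ : 0 < μ) (s : Finset ι)
    (k : ι → H) :
    ENNReal.ofReal (∑ j ∈ s, leverage μ s k j) ≤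
      ∑' i, ENNReal.ofReal ((∑ j ∈ s, ⟪k j, b i⟫_ℝ ^ 2) / ((∑ j ∈ s, ⟪k j, b i⟫_ℝ ^ 2) + μ)) := by
  have h1 : HasSum (fun i => ∑ j ∈ s, ⟪k j, b i⟫_ℝ * ⟪b i, Ring.inverse (regOp μ s k) (k j)⟫_ℝ)
      (∑ j ∈ s, leverage μ s k j) :=
    hasSum_sum fun j _ => b.hasSum_inner_mul_inner _ _
  have h2 : ∀ i, ∑ j ∈ s, ⟪k j, b i⟫_ℝ * ⟪b i, Ring.inverse (regOp μ s k) (k j)⟫_ℝ =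
      1 - μ * ⟪b i, Ring.inverse (regOp μ s k) (b i)⟫_ℝ := by
    intro i
    have hb : ⟪b i, b i⟫_ℝ = 1 := by
      rw [real_inner_self_eq_norm_sq, b.orthonormal.1 i]; norm_num
    have h3 := congrArg (fun v => ⟪b i, v⟫_ℝ) (inverse_regOp hμ s k (b i))
    simp only [regOp_apply, map_add, map_smul, map_sum, inner_add_right, inner_sum,
      inner_smul_right, hb] at h3
    linarith
  -- The right side may be infinite, so finite partial sums are compared before the limit.
  refine le_of_tendsto ((ENNReal.continuous_ofReal.tendsto _).comp h1)
    (Filter.Eventually.of_forall fun t => ?_)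
  refine le_trans ?_ (ENNReal.sum_le_tsum t)
  rw [← ENNReal.ofReal_sum_of_nonneg fun i _ => by positivity]
  refine ENNReal.ofReal_le_ofReal (Finset.sum_le_sum fun i _ => ?_)
  rw [h2]
  exact one_sub_mul_inner_inverse_regOp_le hμ s k (b.orthonormal.1 i)

end RegularizedGram

/-! ### Representers of evaluation -/

section Feature

variable {X : Type*} {H : Type*} [NormedAddCommGroup H] [InnerProductSpace ℝ H] [CompleteSpace H]
  [RKHS ℝ H X ℝ]

variable (H) in
/-- The representer of the evaluation at `x`. -/
noncomputable def feature (x : X) : H := RKHS.kerFun H x 1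

theorem inner_feature (x : X) (f : H) : ⟪feature H x, f⟫_ℝ = f x := by
  simp [feature]

theorem inner_feature_feature (x x' : X) :
    ⟪feature H x, feature H x'⟫_ℝ = RKHS.kernel H x x' 1 := by
  rw [inner_feature, feature, RKHS.kerFun_apply]

variable [TopologicalSpace X] {K : C(X × X, ℝ)}

theorem norm_feature_le (hK : ∀ x x' : X, RKHS.kernel H x x' 1 = K (x, x'))
    (h1 : ∀ x, K (x, x) ≤ 1) (x : X) : ‖feature H x‖ ≤ 1 := by
  have h : ‖feature H x‖ ^ 2 ≤ 1 := by
    rw [← real_inner_self_eq_norm_sq, inner_feature_feature, hK]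
    exact h1 x
  exact (sq_le_one_iff₀ (norm_nonneg _)).1 h

theorem continuous_feature (hK : ∀ x x' : X, RKHS.kernel H x x' 1 = K (x, x')) :
    Continuous (feature H : X → H) := by
  refine continuous_iff_continuousAt.2 fun x => ?_
  rw [ContinuousAt, tendsto_iff_norm_sub_tendsto_zero]
  have h : ∀ x', ‖feature H x' - feature H x‖ = √(K (x', x') - 2 * K (x', x) + K (x, x)) := by
    intro x'
    rw [← hK, ← hK, ← hK, ← inner_feature_feature, ← inner_feature_feature,
      ← inner_feature_feature, real_inner_self_eq_norm_sq, real_inner_self_eq_norm_sq,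
      ← norm_sub_sq_real, Real.sqrt_sq (norm_nonneg _)]
  simp_rw [h]
  have hc : Continuous fun x' => √(K (x', x') - 2 * K (x', x) + K (x, x)) := by fun_prop
  have := hc.tendsto x
  rwa [show K (x, x) - 2 * K (x, x) + K (x, x) = 0 by ring, Real.sqrt_zero] at this

theorem continuous_rkhs (hF : Continuous (feature H : X → H)) (f : H) :
    Continuous fun x => f x := by
  simp_rw [← inner_feature]
  exact hF.inner continuous_const

end Feature

/-! ### Inclusion J of H in `L²` and the covariance operator J*J -/

section Embedding

variable {X : Type*} [TopologicalSpace X] [CompactSpace X] [MeasurableSpace X] [BorelSpace X]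
  {H : Type*} [NormedAddCommGroup H] [InnerProductSpace ℝ H] [CompleteSpace H]
  [RKHS ℝ H X ℝ]

/-- The inclusion of a reproducing kernel Hilbert space of continuous functions in `C(X)`. -/
noncomputable def toContinuousMap (hF : Continuous (feature H : X → H)) : H →L[ℝ] C(X, ℝ) :=
  LinearMap.mkContinuous
    { toFun := fun f => ⟨fun x => f x, continuous_rkhs hF f⟩
      map_add' := fun f g => by ext x; simp
      map_smul' := fun c f => by ext x; simp }
    ‖(⟨feature H, hF⟩ : C(X, H))‖ (fun f => by
      refine (ContinuousMap.norm_le _ (by positivity)).2 fun x => ?_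
      have h : ‖f x‖ ≤ ‖feature H x‖ * ‖f‖ := by
        rw [← inner_feature]; exact norm_inner_le_norm _ _
      refine h.trans ?_
      gcongr
      exact ContinuousMap.norm_coe_le_norm (⟨feature H, hF⟩ : C(X, H)) x)

omit [MeasurableSpace X] [BorelSpace X] in
theorem toContinuousMap_apply (hF : Continuous (feature H : X → H)) (f : H) (x : X) :
    toContinuousMap hF f x = f x := rfl

variable (μ : Measure X) [IsFiniteMeasure μ]

/-- The inclusion of a reproducing kernel Hilbert space of continuous functions in `L²(μ)`. -/
noncomputable def embed (hF : Continuous (feature H : X → H)) : H →L[ℝ] Lp ℝ 2 μ :=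
  (ContinuousMap.toLp (E := ℝ) 2 μ ℝ).comp (toContinuousMap hF)

theorem embed_ae_eq (hF : Continuous (feature H : X → H)) (f : H) :
    embed μ hF f =ᵐ[μ] fun x => f x :=
  ContinuousMap.coeFn_toLp (p := 2) (𝕜 := ℝ) μ (toContinuousMap hF f)

theorem inner_embed (hF : Continuous (feature H : X → H)) (f g : H) :
    ⟪embed μ hF f, embed μ hF g⟫_ℝ = ∫ x, f x * g x ∂μ := by
  have := ContinuousMap.inner_toLp μ (𝕜 := ℝ) (toContinuousMap hF f) (toContinuousMap hF g)
  refine this.trans (integral_congr_ae (Filter.Eventually.of_forall fun x => ?_))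
  simp [toContinuousMap_apply, mul_comm]

variable {K : C(X × X, ℝ)}

theorem embed_feature (hK : ∀ x x' : X, RKHS.kernel H x x' 1 = K (x, x')) (x : X) :
    embed μ (continuous_feature hK) (feature H x) = kernelSection K μ x := by
  have h : toContinuousMap (continuous_feature hK) (feature H x) = K.curry x := by
    ext x'
    change feature H x x' = K (x, x')
    rw [← inner_feature, real_inner_comm, inner_feature_feature, hK]
  exact congrArg (ContinuousMap.toLp (E := ℝ) 2 μ ℝ) h

/-- The factorization L_K = JJ*: at x, the function J*g takes the value ⟨k_x, J*g⟩ = ⟨J k_x, g⟩. It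
links the spectra of L_K and J*J. -/
theorem embed_adjoint_embed (hK : ∀ x x' : X, RKHS.kernel H x x' 1 = K (x, x'))
    (g : Lp ℝ 2 μ) :
    embed μ (continuous_feature hK) ((embed μ (continuous_feature hK)).adjoint g) =
      integralOperator K μ g := by
  have h : toContinuousMap (continuous_feature hK)
      ((embed μ (continuous_feature hK)).adjoint g) = integralFunction K μ g := by
    ext x
    rw [toContinuousMap_apply, ← inner_feature, ContinuousLinearMap.adjoint_inner_right,
      embed_feature μ hK, inner_kernelSection]
    rfl
  exact congrArg (ContinuousMap.toLp (E := ℝ) 2 μ ℝ) h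

omit [CompactSpace X] [BorelSpace X] in
theorem isOpenPosMeasure_of_support_eq {μ : Measure X} (h : μ.support = Set.univ) :
    μ.IsOpenPosMeasure := by
  refine ⟨fun U hU ⟨x, hx⟩ => ?_⟩
  have hx' : x ∈ μ.support := h ▸ Set.mem_univ x
  exact ((Measure.mem_support_iff_forall x).1 hx' U (hU.mem_nhds hx)).ne'

/-- Continuous functions that agree almost everywhere for a measure of full support are equal. -/
theorem embed_injective {μ : Measure X} [IsFiniteMeasure μ] (h : μ.support = Set.univ)
    (hF : Continuous (feature H : X → H)) : Function.Injective (embed μ hF) := by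
  have := isOpenPosMeasure_of_support_eq h
  intro f g hfg
  have h1 : (fun x => f x) =ᵐ[μ] fun x => g x :=
    (embed_ae_eq μ hF f).symm.trans (hfg ▸ embed_ae_eq μ hF g)
  have h2 := ((continuous_rkhs hF f).ae_eq_iff_eq μ (continuous_rkhs hF g)).1 h1
  exact RKHS.ext fun x => congrFun h2 x

/-- The covariance operator of the representers. -/
noncomputable def covOp (hF : Continuous (feature H : X → H)) : H →L[ℝ] H :=
  (embed μ hF).adjoint.comp (embed μ hF)

theorem inner_covOp (hF : Continuous (feature H : X → H)) (f g : H) :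
    ⟪f, covOp μ hF g⟫_ℝ = ∫ x, f x * g x ∂μ := by
  rw [covOp, ContinuousLinearMap.comp_apply, ContinuousLinearMap.adjoint_inner_right, inner_embed]

theorem isSymmetric_covOp (hF : Continuous (feature H : X → H)) :
    (covOp μ hF : H →ₗ[ℝ] H).IsSymmetric := by
  intro f g
  change ⟪covOp μ hF f, g⟫_ℝ = ⟪f, covOp μ hF g⟫_ℝ
  rw [real_inner_comm, inner_covOp, inner_covOp]
  simp only [mul_comm]

/-- The covariance operator is the Bochner integral of the rank one operators k_x ⊗ k_x, and compact
operators form a closed convex set. -/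
theorem isCompactOperator_covOp [SecondCountableTopology X] [IsProbabilityMeasure μ]
    (hF : Continuous (feature H : X → H)) : IsCompactOperator (covOp μ hF) := by
  let R : X → H →L[ℝ] H := fun x => (innerSL ℝ (feature H x)).smulRight (feature H x)
  have hRc : Continuous R := by
    have h : Continuous fun p : H × H => (innerSL ℝ p.1).smulRight p.2 := by
      have := (ContinuousLinearMap.smulRightL ℝ H H).isBoundedBilinearMap.continuous
      exact this.comp (((innerSL ℝ).continuous.comp continuous_fst).prodMk continuous_snd)
    exact h.comp (hF.prodMk hF)
  have hRi : Integrable R μ := by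
    refine Integrable.of_bound hRc.aestronglyMeasurable ‖(⟨R, hRc⟩ : C(X, H →L[ℝ] H))‖
      (Filter.Eventually.of_forall fun x => ?_)
    exact ContinuousMap.norm_coe_le_norm (⟨R, hRc⟩ : C(X, H →L[ℝ] H)) x
  have hR : covOp μ hF = ∫ x, R x ∂μ := by
    refine ContinuousLinearMap.ext fun g => ?_
    refine ext_inner_left ℝ fun f => ?_
    rw [inner_covOp, ContinuousLinearMap.integral_apply hRi, ← integral_inner]
    · refine integral_congr_ae (Filter.Eventually.of_forall fun x => ?_)
      simp only [R, ContinuousLinearMap.smulRight_apply, innerSL_apply_apply, inner_smul_right,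
        inner_feature]
      rw [real_inner_comm, inner_feature, mul_comm]
    · exact hRi.apply_continuousLinearMap g
  have hconv : Convex ℝ {T : H →L[ℝ] H | IsCompactOperator T} := by
    intro S hS T hT a b _ _ _
    exact (IsCompactOperator.smul hS a).add (IsCompactOperator.smul hT b)
  rw [hR]
  refine Convex.integral_mem hconv isClosed_setOfPred_isCompactOperator
    (Filter.Eventually.of_forall fun x => ?_) hRi
  have h1 : IsCompactOperator (ContinuousLinearMap.toSpanSingleton ℝ (feature H x)) :=
    isCompactOperator_of_locallyCompactSpace_rng _
  exact h1.comp_clm (innerSL ℝ (feature H x))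

/-- The eigenspaces of the covariance operator and of the integral operator for a nonzero
eigenvalue are isomorphic. -/
noncomputable def eigenspaceEquiv (hK : ∀ x x' : X, RKHS.kernel H x x' 1 = K (x, x')) {v : ℝ}
    (hv : v ≠ 0) :
    Module.End.eigenspace (covOp μ (continuous_feature hK) : H →ₗ[ℝ] H) v ≃ₗ[ℝ]
      Module.End.eigenspace (integralOperator K μ : Lp ℝ 2 μ →ₗ[ℝ] Lp ℝ 2 μ) v where
  toFun f := ⟨embed μ (continuous_feature hK) f.1, by
    have h := f.2
    rw [Module.End.mem_eigenspace_iff] at h ⊢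
    change (embed μ _).adjoint (embed μ _ f.1) = v • f.1 at h
    change integralOperator K μ _ = _
    rw [← embed_adjoint_embed μ hK, h, map_smul]⟩
  map_add' f g := by ext1; simp
  map_smul' c f := by ext1; simp
  invFun e := ⟨v⁻¹ • (embed μ (continuous_feature hK)).adjoint e.1, by
    have h := e.2
    rw [Module.End.mem_eigenspace_iff] at h ⊢
    change integralOperator K μ _ = _ at h
    change (embed μ _).adjoint (embed μ _ (v⁻¹ • (embed μ _).adjoint e.1)) = _
    rw [map_smul, embed_adjoint_embed μ hK, h, map_smul, map_smul, smul_comm]⟩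
  left_inv f := by
    have h := f.2
    rw [Module.End.mem_eigenspace_iff] at h
    change (embed μ _).adjoint (embed μ _ f.1) = v • f.1 at h
    ext1
    change v⁻¹ • (embed μ _).adjoint (embed μ _ f.1) = _
    rw [h, smul_smul, inv_mul_cancel₀ hv, one_smul]
  right_inv e := by
    have h := e.2
    rw [Module.End.mem_eigenspace_iff] at h
    change integralOperator K μ _ = _ at h
    ext1
    change embed μ _ (v⁻¹ • (embed μ _).adjoint e.1) = _
    rw [map_smul, embed_adjoint_embed μ hK, h, smul_smul, inv_mul_cancel₀ hv, one_smul]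

end Embedding

/-! ### Eigenbasis of the covariance operator -/

section Mercer

variable {X : Type*} [TopologicalSpace X] [CompactSpace X] [MeasurableSpace X] [BorelSpace X]
  [SecondCountableTopology X]
  {H : Type*} [NormedAddCommGroup H] [InnerProductSpace ℝ H] [CompleteSpace H]
  [RKHS ℝ H X ℝ] {K : C(X × X, ℝ)}

/-- A basis of the reproducing kernel Hilbert space that is orthogonal in `L²(μ)`, whose squared
`L²` norms run through the positive eigenvalues of the integral operator with multiplicity. -/
theorem exists_hilbertBasis_eigenvalues (μ : Measure X) [IsProbabilityMeasure μ]
    (hs : μ.support = Set.univ) (hK : ∀ x x' : X, RKHS.kernel H x x' 1 = K (x, x')) {b : ℝ}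
    (hb : tracePow (integralOperator K μ) b ≠ ⊤) :
    ∃ (κ : Type) (_ : Countable κ) (e : HilbertBasis κ ℝ H) (ν : κ → ℝ), (∀ i, 0 < ν i) ∧
      (∀ i, ∫ x, e i x ^ 2 ∂μ = ν i) ∧
      ∀ c, tracePow (integralOperator K μ) c = ∑' i, ENNReal.ofReal (ν i ^ c) := by
  have hF := continuous_feature hK
  let E : Set.Ioi (0 : ℝ) → Submodule ℝ H := fun v =>
    Module.End.eigenspace (covOp μ hF : H →ₗ[ℝ] H) (v : ℝ)
  have hfin : ∀ v, FiniteDimensional ℝ (E v) := fun v =>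
    ContinuousLinearMap.finite_dimensional_eigenspace (isCompactOperator_covOp μ hF) _ v.2.ne'
  -- Compactness makes these eigenspaces finite dimensional, so the multiplicities in `tracePow` are
  -- natural numbers.
  have hrank : ∀ v : Set.Ioi (0 : ℝ), (((Module.rank ℝ (Module.End.eigenspace
      (integralOperator K μ : Lp ℝ 2 μ →ₗ[ℝ] Lp ℝ 2 μ) (v : ℝ))).toENat : ℕ∞) : ℝ≥0∞) =
      (Module.finrank ℝ (E v) : ℝ≥0∞) := by
    intro v
    have h := (eigenspaceEquiv μ hK v.2.ne').lift_rank_eq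
    have h2 := congrArg Cardinal.toENat h
    rw [Cardinal.toENat_lift, Cardinal.toENat_lift] at h2
    rw [← h2, ← Module.finrank_eq_rank ℝ (E v), Cardinal.toENat_nat, ENat.toENNReal_coe]
  let κ := Σ v : Set.Ioi (0 : ℝ), Fin (Module.finrank ℝ (E v))
  have htr : ∀ c, tracePow (integralOperator K μ) c =
      ∑' i : κ, ENNReal.ofReal ((i.1 : ℝ) ^ c) := by
    intro c
    rw [ENNReal.tsum_sigma' (fun i : κ => ENNReal.ofReal ((i.1 : ℝ) ^ c)), tracePow]
    refine tsum_congr fun v => ?_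
    rw [hrank, tsum_fintype]
    simp
  -- A convergent sum of strictly positive terms has countably many of them; this is where
  -- finiteness of the trace enters.
  have hκ : Countable κ := by
    have h := htr b
    have h2 := Summable.countable_support_ennreal (h ▸ hb)
    rwa [show (Function.support fun i : κ => ENNReal.ofReal ((i.1 : ℝ) ^ b)) = Set.univ from
      Set.eq_univ_of_forall fun i => by
        simpa using Real.rpow_pos_of_pos i.1.2 b, Set.countable_univ_iff] at h2
  have hort : OrthogonalFamily ℝ (fun v => E v) fun v => (E v).subtypeₗᵢ :=
    (isSymmetric_covOp μ hF).orthogonalFamily_eigenspaces.comp Subtype.coe_injective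
  let w : κ → H := fun i => (stdOrthonormalBasis ℝ (E i.1) i.2 : H)
  have hw : Orthonormal ℝ w := hort.orthonormal_sigma_orthonormal
    (v_family := fun v => stdOrthonormalBasis ℝ (E v))
    (fun v => (stdOrthonormalBasis ℝ (E v)).orthonormal)
  have hmem : ∀ i, covOp μ hF (w i) = (i.1 : ℝ) • w i := fun i =>
    Module.End.mem_eigenspace_iff.1 (stdOrthonormalBasis ℝ (E i.1) i.2).2
  have hcompl : (Submodule.span ℝ (Set.range w))ᗮ = ⊥ := by
    rw [Submodule.eq_bot_iff]
    intro f hf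
    have hfE : ∀ v : Set.Ioi (0 : ℝ), f ∈ (E v)ᗮ := by
      intro v g hg
      have hrepr := (stdOrthonormalBasis ℝ (E v)).sum_repr ⟨g, hg⟩
      have hg' : g = ∑ j, (stdOrthonormalBasis ℝ (E v)).repr ⟨g, hg⟩ j • w ⟨v, j⟩ := by
        have h := congrArg (Subtype.val) hrepr
        rw [Submodule.coe_sum] at h
        exact h.symm
      rw [hg', sum_inner]
      refine Finset.sum_eq_zero fun j _ => ?_
      rw [inner_smul_left, hf (w ⟨v, j⟩) (Submodule.subset_span ⟨⟨v, j⟩, rfl⟩), mul_zero]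
    have hall : f ∈ (⨆ v : ℝ, Module.End.eigenspace (covOp μ hF : H →ₗ[ℝ] H) v)ᗮ := by
      rw [← Submodule.iInf_orthogonal, Submodule.mem_iInf]
      intro v
      rcases lt_or_ge 0 v with hv | hv
      · exact hfE ⟨v, hv⟩
      -- If J*J g = v g with v ≤ 0, then ‖Jg‖² = v‖g‖² ≤ 0, so g = 0 by injectivity of J. The
      -- eigenvectors for positive eigenvalues are therefore total.
      · have hbot : Module.End.eigenspace (covOp μ hF : H →ₗ[ℝ] H) v = ⊥ := by
          rw [Submodule.eq_bot_iff]
          intro g hg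
          have hg' : covOp μ hF g = v • g := Module.End.mem_eigenspace_iff.1 hg
          have h1 : ‖embed μ hF g‖ ^ 2 = v * ‖g‖ ^ 2 := by
            rw [← real_inner_self_eq_norm_sq, inner_embed, ← inner_covOp μ hF, hg', inner_smul_right,
              real_inner_self_eq_norm_sq]
          have h2 : ‖embed μ hF g‖ ^ 2 = 0 :=
            le_antisymm (h1 ▸ mul_nonpos_of_nonpos_of_nonneg hv (sq_nonneg _)) (sq_nonneg _)
          have h3 : embed μ hF g = embed μ hF 0 := by
            rw [map_zero]; exact norm_eq_zero.1 (pow_eq_zero_iff two_ne_zero |>.1 h2)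
          exact embed_injective hs hF h3
        rw [hbot]
        simp
    have := ContinuousLinearMap.orthogonalComplement_iSup_eigenspaces_eq_bot
      (isCompactOperator_covOp μ hF) (isSymmetric_covOp μ hF)
    rw [this] at hall
    exact (Submodule.mem_bot ℝ).1 hall
  refine ⟨κ, hκ, HilbertBasis.mkOfOrthogonalEqBot hw hcompl, fun i => i.1, fun i => i.1.2,
    fun i => ?_, htr⟩
  rw [HilbertBasis.coe_mkOfOrthogonalEqBot]
  have h := inner_covOp μ hF (w i) (w i)
  rw [hmem, inner_smul_right, real_inner_self_eq_norm_sq, hw.1 i] at h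
  simp only [sq]
  linarith

end Mercer

/-! ### Approximation error under the source condition -/

section Approximation

variable {E : Type*} [NormedAddCommGroup E] [InnerProductSpace ℝ E] [CompleteSpace E]

/-- Bessel's inequality for the mutually orthogonal eigenspaces. -/
theorem sum_norm_starProjection_sq_le {L : E →L[ℝ] E} (hL : (L : E →ₗ[ℝ] E).IsSymmetric)
    (s : Finset (Set.Ioi (0 : ℝ))) (g : E) :
    ∑ v ∈ s, ‖(Module.End.eigenspace (L : E →ₗ[ℝ] E) (v : ℝ)).starProjection g‖ ^ 2 ≤
      ‖g‖ ^ 2 := by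
  let P : Set.Ioi (0 : ℝ) → E := fun v =>
    (Module.End.eigenspace (L : E →ₗ[ℝ] E) (v : ℝ)).starProjection g
  have hort : OrthogonalFamily ℝ
      (fun v : Set.Ioi (0 : ℝ) => Module.End.eigenspace (L : E →ₗ[ℝ] E) (v : ℝ))
      fun v => (Module.End.eigenspace (L : E →ₗ[ℝ] E) (v : ℝ)).subtypeₗᵢ :=
    hL.orthogonalFamily_eigenspaces.comp Subtype.coe_injective
  have h1 : ‖∑ v ∈ s, P v‖ ^ 2 = ∑ v ∈ s, ‖P v‖ ^ 2 := by
    have := hort.norm_sum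
      (fun v => (Module.End.eigenspace (L : E →ₗ[ℝ] E) (v : ℝ)).orthogonalProjectionOnto g) s
    simpa [P] using this
  have h2 : ⟪∑ v ∈ s, P v, g⟫_ℝ = ∑ v ∈ s, ‖P v‖ ^ 2 := by
    rw [sum_inner]
    refine Finset.sum_congr rfl fun v _ => ?_
    have h3 := Submodule.inner_starProjection_left_eq_right
      (Module.End.eigenspace (L : E →ₗ[ℝ] E) (v : ℝ)) (P v) g
    rw [Submodule.starProjection_eq_self_iff.2 (Submodule.starProjection_apply_mem _ _)] at h3
    rw [h3, real_inner_self_eq_norm_sq]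
  have h3 := norm_sub_sq_real (∑ v ∈ s, P v) g
  have h4 := sq_nonneg ‖∑ v ∈ s, P v - g‖
  change ∑ v ∈ s, ‖P v‖ ^ 2 ≤ _
  linarith

/-- Weighted AM-GM with weights 2β and 1 - 2β; this is where β ≤ 1/2 is needed. -/
theorem rpow_two_mul_div_le {v lam β : ℝ} (hv : 0 < v) (hl : 0 < lam) (hβ : 0 < β)
    (hβ' : β ≤ 1 / 2) : lam * (v ^ β * v ^ β / (v + lam)) ≤ lam ^ (2 * β) := by
  have h := Real.geom_mean_le_arith_mean2_weighted (w₁ := 2 * β) (w₂ := 1 - 2 * β) (by linarith)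
    (by linarith) hv.le hl.le (by ring)
  have h2 : 2 * β * v + (1 - 2 * β) * lam ≤ v + lam := by nlinarith
  have h3 : lam = lam ^ (2 * β) * lam ^ (1 - 2 * β) := by
    rw [← Real.rpow_add hl]; simp
  rw [← Real.rpow_add hv, ← two_mul, mul_div_assoc', div_le_iff₀ (by positivity)]
  calc lam * v ^ (2 * β) = lam ^ (2 * β) * (v ^ (2 * β) * lam ^ (1 - 2 * β)) := by
        conv_lhs => rw [h3]
        ring
    _ ≤ _ := by gcongr; exact h.trans h2

/-- The witness is h = (L + λ)⁻¹F for the finite spectral sum F. The penalized error then collapses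
to λ⟨h, F⟩ = Σ λ v^(2β)/(v + λ) ‖P_v g‖². When L = JJ*, the competitor in H is J*h, with ‖J*h‖² =
⟨h, Lh⟩ and J(J*h) = Lh. -/
theorem penalized_partial_sum_le {L : E →L[ℝ] E} (hL : (L : E →ₗ[ℝ] E).IsSymmetric) {β lam : ℝ}
    (hβ : 0 < β) (hβ' : β ≤ 1 / 2) (hl : 0 < lam) (s : Finset (Set.Ioi (0 : ℝ))) (g : E) :
    ∃ h : E, lam * ⟪h, L h⟫_ℝ + ‖L h - ∑ v ∈ s, ((v : ℝ) ^ β) •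
      (Module.End.eigenspace (L : E →ₗ[ℝ] E) (v : ℝ)).starProjection g‖ ^ 2 ≤
      lam ^ (2 * β) * ‖g‖ ^ 2 := by
  let P : Set.Ioi (0 : ℝ) → E := fun v =>
    (Module.End.eigenspace (L : E →ₗ[ℝ] E) (v : ℝ)).starProjection g
  have hP : ∀ v, L (P v) = (v : ℝ) • P v := fun v =>
    Module.End.mem_eigenspace_iff.1 (Submodule.starProjection_apply_mem _ _)
  have hort : OrthogonalFamily ℝ
      (fun v : Set.Ioi (0 : ℝ) => Module.End.eigenspace (L : E →ₗ[ℝ] E) (v : ℝ))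
      fun v => (Module.End.eigenspace (L : E →ₗ[ℝ] E) (v : ℝ)).subtypeₗᵢ :=
    hL.orthogonalFamily_eigenspaces.comp Subtype.coe_injective
  have hPP : ∀ v w, v ≠ w → ⟪P v, P w⟫_ℝ = 0 := fun v w hvw =>
    hort hvw ⟨P v, Submodule.starProjection_apply_mem _ _⟩
      ⟨P w, Submodule.starProjection_apply_mem _ _⟩
  set F : E := ∑ v ∈ s, ((v : ℝ) ^ β) • P v with hF
  let h : E := ∑ v ∈ s, ((v : ℝ) ^ β / ((v : ℝ) + lam)) • P v
  have hLh : L h + lam • h = F := by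
    simp only [h, map_sum, map_smul, hP, Finset.smul_sum, ← Finset.sum_add_distrib, smul_smul,
      ← add_smul, hF]
    refine Finset.sum_congr rfl fun v _ => ?_
    have : (v : ℝ) + lam ≠ 0 := (add_pos v.2 hl).ne'
    congr 1
    field_simp
  refine ⟨h, ?_⟩
  have h1 : L h - F = -(lam • h) := by rw [← hLh]; abel
  have h2 : lam * ⟪h, L h⟫_ℝ + ‖L h - F‖ ^ 2 = lam * ⟪h, F⟫_ℝ := by
    rw [h1, norm_neg, norm_smul, mul_pow, Real.norm_eq_abs, sq_abs,
      ← real_inner_self_eq_norm_sq, ← hLh, inner_add_right, inner_smul_right]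
    ring
  have h3 : ⟪h, F⟫_ℝ = ∑ v ∈ s, ((v : ℝ) ^ β * (v : ℝ) ^ β / ((v : ℝ) + lam)) * ‖P v‖ ^ 2 := by
    rw [sum_inner]
    refine Finset.sum_congr rfl fun v hv => ?_
    rw [hF, inner_sum, Finset.sum_eq_single v]
    · rw [inner_smul_left, inner_smul_right, real_inner_self_eq_norm_sq, conj_trivial]
      ring
    · intro w _ hw
      rw [inner_smul_left, inner_smul_right, hPP v w hw.symm]
      simp
    · exact fun hc => absurd hv hc
  rw [h2, h3, Finset.mul_sum]
  calc ∑ v ∈ s, lam * (((v : ℝ) ^ β * (v : ℝ) ^ β / ((v : ℝ) + lam)) * ‖P v‖ ^ 2)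
      ≤ ∑ v ∈ s, lam ^ (2 * β) * ‖P v‖ ^ 2 := by
        refine Finset.sum_le_sum fun v _ => ?_
        rw [← mul_assoc]
        gcongr
        exact rpow_two_mul_div_le v.2 hl hβ hβ'
    _ ≤ _ := by
        rw [← Finset.mul_sum]
        gcongr
        exact sum_norm_starProjection_sq_le hL s g

/-- The approximation error of regularized least squares under a source condition: a bound that
holds for the penalized error of every `u` also holds for the value given by the source
condition. -/
theorem le_of_forall_penalized {H : Type*} [NormedAddCommGroup H] [InnerProductSpace ℝ H]
    [CompleteSpace H] (J : H →L[ℝ] E) {L : E →L[ℝ] E} (hJ : ∀ g, J (J.adjoint g) = L g)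
    {β lam c d B : ℝ} (hβ : 0 < β) (hβ' : β ≤ 1 / 2) (hl : 0 < lam) (hc : 0 ≤ c) {g f : E}
    (hfg : IsPowApply L β g f)
    (hB : ∀ u : H, B ≤ c * (lam * ‖u‖ ^ 2 + ‖J u - f‖ ^ 2) + d) :
    B ≤ c * (lam ^ (2 * β) * ‖g‖ ^ 2) + d := by
  have hinner : ∀ a b : E, ⟪a, L b⟫_ℝ = ⟪J.adjoint a, J.adjoint b⟫_ℝ := fun a b => by
    rw [← hJ, ContinuousLinearMap.adjoint_inner_left]
  have hL : (L : E →ₗ[ℝ] E).IsSymmetric := by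
    intro a b
    change ⟪L a, b⟫_ℝ = ⟪a, L b⟫_ℝ
    rw [real_inner_comm, hinner, hinner, real_inner_comm]
  set F : Finset (Set.Ioi (0 : ℝ)) → E := fun s => ∑ v ∈ s, ((v : ℝ) ^ β) •
      (Module.End.eigenspace (L : E →ₗ[ℝ] E) (v : ℝ)).starProjection g with hF
  set Λ := lam ^ (2 * β) * ‖g‖ ^ 2 with hΛ
  have hΛ0 : 0 ≤ Λ := by positivity
  have hlim : Filter.Tendsto (fun s => ‖F s - f‖) Filter.atTop (nhds 0) :=
    tendsto_iff_norm_sub_tendsto_zero.1 hfg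
  -- The competitor is built for the partial sum `F s`; replacing it by `f` costs terms that vanish
  -- in the limit.
  have hbound : ∀ s, B ≤ c * (Λ + 2 * √Λ * ‖F s - f‖ + ‖F s - f‖ ^ 2) + d := by
    intro s
    obtain ⟨h, hh⟩ := penalized_partial_sum_le hL hβ hβ' hl s g
    change lam * ⟪h, L h⟫_ℝ + ‖L h - F s‖ ^ 2 ≤ Λ at hh
    refine (hB (J.adjoint h)).trans ?_
    have h0 : 0 ≤ ⟪h, L h⟫_ℝ := by rw [hinner]; exact real_inner_self_nonneg
    have h1 : ‖J.adjoint h‖ ^ 2 = ⟪h, L h⟫_ℝ := by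
      rw [hinner, real_inner_self_eq_norm_sq]
    have h2 : ‖L h - F s‖ ≤ √Λ :=
      Real.le_sqrt_of_sq_le (le_trans (le_add_of_nonneg_left (by positivity)) hh)
    have h3 : ‖L h - f‖ ≤ ‖L h - F s‖ + ‖F s - f‖ := norm_sub_le_norm_sub_add_norm_sub _ _ _
    have h4 : ‖L h - f‖ ^ 2 ≤ (‖L h - F s‖ + ‖F s - f‖) ^ 2 := by gcongr
    have h5 : ‖L h - F s‖ * ‖F s - f‖ ≤ √Λ * ‖F s - f‖ := by gcongr
    rw [h1, hJ]
    have h6 : lam * ⟪h, L h⟫_ℝ + ‖L h - f‖ ^ 2 ≤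
        Λ + 2 * √Λ * ‖F s - f‖ + ‖F s - f‖ ^ 2 := by nlinarith
    gcongr
  have hlim2 : Filter.Tendsto
      (fun s => c * (Λ + 2 * √Λ * ‖F s - f‖ + ‖F s - f‖ ^ 2) + d) Filter.atTop
      (nhds (c * (Λ + 2 * √Λ * 0 + 0 ^ 2) + d)) :=
    (((hlim.const_mul _).const_add _ |>.add (hlim.pow 2)).const_mul c).add_const d
  have := ge_of_tendsto' hlim2 hbound
  simpa using this

/-- In rank zero the claimed excess risk bound is 0, so the source term must vanish too: here g may
be replaced by 0. -/
theorem isPowApply_zero_of_tracePow_eq_zero {L : E →L[ℝ] E} {β : ℝ} {g f : E}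
    (h : tracePow L 0 = 0) (hfg : IsPowApply L β g f) : IsPowApply L β 0 f := by
  have hbot : ∀ v : Set.Ioi (0 : ℝ), Module.End.eigenspace (L : E →ₗ[ℝ] E) (v : ℝ) = ⊥ := by
    intro v
    have := ENNReal.tsum_eq_zero.1 h v
    simpa using this
  have hz : f = 0 := by
    refine hfg.unique ?_
    convert hasSum_zero with v
    have hm := (hbot v).le (Submodule.starProjection_apply_mem
      (Module.End.eigenspace (L : E →ₗ[ℝ] E) (v : ℝ)) g)
    rw [(Submodule.mem_bot ℝ).1 hm, smul_zero]
  rw [IsPowApply, hz]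
  simp

end Approximation

/-! ### Regression function and Bayes risk -/

section RegressionFunction

variable {X : Type*} [MeasurableSpace X] {ρ : Measure (X × ℝ)} [IsProbabilityMeasure ρ] {Y : ℝ}

theorem nonneg_of_label_bounded (hY : ∀ᵐ p ∂ρ, |p.2| ≤ Y) : 0 ≤ Y := by
  obtain ⟨p, hp⟩ := hY.exists
  exact (abs_nonneg _).trans hp

theorem measurable_regressionFunction : Measurable (regressionFunction ρ) :=
  (stronglyMeasurable_id.integral_kernel (κ := ρ.condKernel)).measurable

theorem ae_condKernel_label_bounded (hY : ∀ᵐ p ∂ρ, |p.2| ≤ Y) :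
    ∀ᵐ x ∂ρ.fst, ∀ᵐ y ∂ρ.condKernel x, |y| ≤ Y := by
  rw [← ρ.disintegrate ρ.condKernel] at hY
  exact Measure.ae_ae_of_ae_compProd hY

theorem abs_regressionFunction_le (hY : ∀ᵐ p ∂ρ, |p.2| ≤ Y) :
    ∀ᵐ x ∂ρ.fst, |regressionFunction ρ x| ≤ Y := by
  filter_upwards [ae_condKernel_label_bounded hY] with x hx
  have h := norm_integral_le_of_norm_le_const (μ := ρ.condKernel x) (f := fun y => y) hx
  simpa [regressionFunction] using h

omit [IsProbabilityMeasure ρ] in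
theorem ae_of_ae_fst {p : X → Prop} (h : ∀ᵐ x ∂ρ.fst, p x) : ∀ᵐ q ∂ρ, p q.1 :=
  ae_of_ae_map measurable_fst.aemeasurable h

omit [IsProbabilityMeasure ρ] in
theorem integral_fst {f : X → ℝ} (hf : AEStronglyMeasurable f ρ.fst) :
    ∫ x, f x ∂ρ.fst = ∫ p, f p.1 ∂ρ :=
  integral_map measurable_fst.aemeasurable hf

theorem risk_eq_add_bayesRisk (hY : ∀ᵐ p ∂ρ, |p.2| ≤ Y) {f : X → ℝ} (hf : Measurable f) {B : ℝ}
    (hB : ∀ x, |f x| ≤ B) :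
    risk ρ f = ∫ x, (f x - regressionFunction ρ x) ^ 2 ∂ρ.fst + bayesRisk ρ := by
  set r := regressionFunction ρ with hr
  have hrm : Measurable r := measurable_regressionFunction
  have hrY := ae_of_ae_fst (abs_regressionFunction_le hY)
  have hbd : ∀ᵐ p ∂ρ, |f p.1| ≤ B ∧ |r p.1| ≤ Y ∧ |p.2| ≤ Y := by
    filter_upwards [hY, hrY] with p h1 h2 using ⟨hB _, h2, h1⟩
  have hi1 : Integrable (fun p : X × ℝ => (f p.1 - r p.1) ^ 2) ρ := by
    refine Integrable.of_bound (by fun_prop) ((B + Y) ^ 2) ?_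
    filter_upwards [hbd] with p ⟨h1, h2, h3⟩
    rw [norm_pow]
    gcongr
    exact (abs_sub _ _).trans (add_le_add h1 h2)
  have hi2 : Integrable (fun p : X × ℝ => (f p.1 - r p.1) * (r p.1 - p.2)) ρ := by
    refine Integrable.of_bound (by fun_prop) ((B + Y) * (Y + Y)) ?_
    filter_upwards [hbd] with p ⟨h1, h2, h3⟩
    rw [norm_mul]
    have hB0 : 0 ≤ B := (abs_nonneg _).trans h1
    have hY0 : 0 ≤ Y := (abs_nonneg _).trans h2
    exact mul_le_mul ((abs_sub _ _).trans (add_le_add h1 h2))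
      ((abs_sub _ _).trans (add_le_add h2 h3)) (norm_nonneg _) (by positivity)
  have hi3 : Integrable (fun p : X × ℝ => (r p.1 - p.2) ^ 2) ρ := by
    refine Integrable.of_bound (by fun_prop) ((Y + Y) ^ 2) ?_
    filter_upwards [hbd] with p ⟨h1, h2, h3⟩
    rw [norm_pow]
    gcongr
    exact (abs_sub _ _).trans (add_le_add h2 h3)
  -- Integrating over the label first, r(x) - y has conditional mean zero.
  have hcross : ∫ p, (f p.1 - r p.1) * (r p.1 - p.2) ∂ρ = 0 := by
    rw [← Measure.integral_condKernel hi2]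
    refine integral_eq_zero_of_ae ?_
    filter_upwards [ae_condKernel_label_bounded hY] with x hx
    have hid : Integrable (fun y : ℝ => y) (ρ.condKernel x) :=
      Integrable.of_bound aestronglyMeasurable_id Y hx
    change ∫ y, (f x - r x) * (r x - y) ∂ρ.condKernel x = 0
    rw [integral_const_mul, integral_sub (integrable_const _) hid, integral_const]
    simp [hr, regressionFunction]
  rw [integral_fst (by fun_prop), bayesRisk, risk, risk, ← hr]
  calc ∫ p, (f p.1 - p.2) ^ 2 ∂ρ
      = ∫ p, ((f p.1 - r p.1) ^ 2 + 2 * ((f p.1 - r p.1) * (r p.1 - p.2)) +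
          (r p.1 - p.2) ^ 2) ∂ρ := by
        congr 1; ext p; ring
    _ = _ := by
        have hi4 : Integrable (fun p : X × ℝ => (f p.1 - r p.1) ^ 2 +
          2 * ((f p.1 - r p.1) * (r p.1 - p.2))) ρ := hi1.add (hi2.const_mul 2)
        rw [integral_add hi4 hi3, integral_add hi1 (hi2.const_mul 2),
          integral_const_mul, hcross]
        ring

theorem bayesRisk_nonneg (ρ : Measure (X × ℝ)) [IsProbabilityMeasure ρ] : 0 ≤ bayesRisk ρ :=
  integral_nonneg fun _ => sq_nonneg _

end RegressionFunction

/-! ### Truncation -/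

section Truncation

theorem truncate_eq {Y : ℝ} (hY : 0 ≤ Y) (z : ℝ) : truncate Y z = max (-Y) (min Y z) := by
  unfold truncate
  rcases lt_trichotomy z 0 with h | h | h
  · rw [Real.sign_of_neg h, abs_of_neg h, min_eq_right (h.le.trans hY), mul_neg_one, ← max_neg_neg,
      neg_neg]
  · subst h
    simp [hY]
  · rw [Real.sign_of_pos h, abs_of_pos h, mul_one, max_eq_right]
    have : 0 ≤ min Y z := le_min hY h.le
    linarith

theorem measurable_truncate {Y : ℝ} (hY : 0 ≤ Y) : Measurable (truncate Y) := by
  have : truncate Y = fun z => max (-Y) (min Y z) := funext (truncate_eq hY)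
  rw [this]
  fun_prop

theorem truncate_sub_sq_le {Y z y : ℝ} (hy : |y| ≤ Y) :
    (truncate Y z - y) ^ 2 ≤ (z - y) ^ 2 := by
  have hY : 0 ≤ Y := (abs_nonneg _).trans hy
  obtain ⟨h1, h2⟩ := abs_le.1 hy
  rw [truncate_eq hY]
  refine sq_le_sq.2 ?_
  rcases le_total Y z with h | h
  · rw [min_eq_left h, max_eq_right (by linarith), abs_of_nonneg (by linarith),
      abs_of_nonneg (by linarith)]
    linarith
  · rw [min_eq_right h]
    rcases le_total (-Y) z with h' | h'
    · rw [max_eq_right h']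
    · rw [max_eq_left h', abs_of_nonpos (by linarith), abs_of_nonpos (by linarith)]
      linarith

theorem truncate_sub_sq_le_const {Y z y : ℝ} (hy : |y| ≤ Y) :
    (truncate Y z - y) ^ 2 ≤ 4 * Y ^ 2 := by
  have hY : 0 ≤ Y := (abs_nonneg _).trans hy
  obtain ⟨h1, h2⟩ := abs_le.1 hy
  rw [truncate_eq hY]
  have h3 : max (-Y) (min Y z) ≤ Y := max_le (by linarith) (min_le_left _ _)
  have h4 : -Y ≤ max (-Y) (min Y z) := le_max_left _ _
  nlinarith

end Truncation

/-! ### Symmetries of the i.i.d. sample -/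

section Sampling

variable {Z : Type*} [MeasurableSpace Z] (ρ : Measure Z) [IsProbabilityMeasure ρ] {n : ℕ}

theorem measurePreserving_comp_perm (σ : Equiv.Perm (Fin n)) :
    MeasurePreserving (fun S : Fin n → Z => S ∘ σ) (Measure.pi fun _ => ρ)
      (Measure.pi fun _ => ρ) := by
  refine ⟨by fun_prop, (Measure.pi_eq fun s hs => ?_).symm⟩
  rw [Measure.map_apply (by fun_prop) (MeasurableSet.univ_pi hs)]
  have : (fun S : Fin n → Z => S ∘ σ) ⁻¹' Set.univ.pi s =
      Set.univ.pi fun i => s (σ.symm i) := by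
    ext S
    simp only [Set.mem_preimage, Set.mem_univ_pi, Function.comp_apply]
    exact ⟨fun h i => by simpa using h (σ.symm i), fun h i => by simpa using h (σ i)⟩
  rw [this, Measure.pi_pi]
  exact Equiv.prod_comp σ.symm fun i => ρ (s i)

/-- Resampling one coordinate: it turns an independent test point into sample k. -/
theorem measurePreserving_update (k : Fin n) :
    MeasurePreserving (fun q : (Fin n → Z) × Z => Function.update q.1 k q.2)
      ((Measure.pi fun _ => ρ).prod ρ) (Measure.pi fun _ => ρ) := by
  have hm : Measurable fun q : (Fin n → Z) × Z => Function.update q.1 k q.2 := by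
    refine measurable_pi_iff.2 fun i => ?_
    by_cases h : i = k
    · subst h; simpa using measurable_snd
    · simp only [Function.update_of_ne h]; fun_prop
  refine ⟨hm, (Measure.pi_eq fun s hs => ?_).symm⟩
  rw [Measure.map_apply hm (MeasurableSet.univ_pi hs)]
  have : (fun q : (Fin n → Z) × Z => Function.update q.1 k q.2) ⁻¹' Set.univ.pi s =
      (Set.univ.pi (Function.update s k Set.univ)) ×ˢ (s k) := by
    ext ⟨S, p⟩
    simp only [Set.mem_preimage, Set.mem_univ_pi, Set.mem_prod]
    constructor
    · intro h
      refine ⟨fun i => ?_, by simpa using h k⟩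
      by_cases hi : i = k
      · subst hi; simp
      · simpa [Function.update_of_ne hi] using h i
    · rintro ⟨h, h'⟩ i
      by_cases hi : i = k
      · subst hi; simpa using h'
      · simpa [Function.update_of_ne hi] using h i
  rw [this, Measure.prod_prod, Measure.pi_pi, ← Finset.mul_prod_erase _ _ (Finset.mem_univ k),
    ← Finset.mul_prod_erase _ (fun i => ρ (s i)) (Finset.mem_univ k)]
  have h2 : ∏ i ∈ Finset.univ.erase k, ρ (Function.update s k Set.univ i) =
      ∏ i ∈ Finset.univ.erase k, ρ (s i) :=
    Finset.prod_congr rfl fun i hi => by rw [Function.update_of_ne (Finset.ne_of_mem_erase hi)]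
  rw [h2, Function.update_self, measure_univ, one_mul, mul_comm]

end Sampling

/-! ### Dependence of solutions and leverage scores on the data -/

section Congr

variable {H : Type*} [NormedAddCommGroup H] [InnerProductSpace ℝ H] [CompleteSpace H] {ι : Type*}

omit [CompleteSpace H] in
theorem regSol_congr {μ : ℝ} {s : Finset ι} {k k' : ι → H} {y y' : ι → ℝ}
    (hk : ∀ i ∈ s, k i = k' i) (hy : ∀ i ∈ s, y i = y' i) :
    regSol μ s k y = regSol μ s k' y' := by
  have h1 : regOp μ s k = regOp μ s k' := by
    rw [regOp, regOp]
    congr 1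
    exact Finset.sum_congr rfl fun i hi => by rw [hk i hi]
  rw [regSol, regSol, h1]
  congr 1
  exact Finset.sum_congr rfl fun i hi => by rw [hk i hi, hy i hi]

omit [CompleteSpace H] in
theorem leverage_comp_perm (μ : ℝ) {s : Finset ι} (σ : Equiv.Perm ι) (hσ : ∀ i, i ∈ s ↔ σ i ∈ s)
    (k : ι → H) (j : ι) : leverage μ s (k ∘ σ) j = leverage μ s k (σ j) := by
  have h1 : regOp μ s (k ∘ σ) = regOp μ s k := by
    rw [regOp, regOp]
    congr 1
    exact Finset.sum_equiv σ hσ fun i _ => rfl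
  rw [leverage, leverage, h1]
  rfl

/-- Inversion is continuous at units. All measurability in the sample rests on this. -/
theorem continuous_inverse_regOp {Ω : Type*} [TopologicalSpace Ω] {μ : ℝ} (hμ : 0 < μ)
    (s : Finset ι) {k : Ω → ι → H} (hk : ∀ i, Continuous fun ω => k ω i) :
    Continuous fun ω => Ring.inverse (regOp μ s (k ω)) := by
  have h1 : Continuous fun ω => regOp μ s (k ω) := by
    refine continuous_const.add (continuous_finsetSum _ fun i _ => ?_)
    have := (ContinuousLinearMap.smulRightL ℝ H H).isBoundedBilinearMap.continuous
    exact this.comp (((innerSL ℝ).continuous.comp (hk i)).prodMk (hk i))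
  refine continuous_iff_continuousAt.2 fun ω => ?_
  obtain ⟨u, hu⟩ := isUnit_regOp hμ s (k ω)
  have h2 := NormedRing.inverse_continuousAt u
  rw [hu] at h2
  exact ContinuousAt.comp (f := fun ω => regOp μ s (k ω)) h2 h1.continuousAt

theorem continuous_regSol {Ω : Type*} [TopologicalSpace Ω] {μ : ℝ} (hμ : 0 < μ)
    (s : Finset ι) {k : Ω → ι → H} (hk : ∀ i, Continuous fun ω => k ω i) {y : Ω → ι → ℝ}
    (hy : ∀ i, Continuous fun ω => y ω i) : Continuous fun ω => regSol μ s (k ω) (y ω) :=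
  (continuous_inverse_regOp hμ s hk).clm_apply
    (continuous_finsetSum _ fun i _ => (hy i).smul (hk i))

theorem continuous_leverage {Ω : Type*} [TopologicalSpace Ω] {μ : ℝ} (hμ : 0 < μ)
    (s : Finset ι) {k : Ω → ι → H} (hk : ∀ i, Continuous fun ω => k ω i) (j : ι) :
    Continuous fun ω => leverage μ s (k ω) j :=
  (hk j).inner ((continuous_inverse_regOp hμ s hk).clm_apply (hk j))

end Congr

/-! ### Candidate functions of the algorithm -/

section Ridge

variable {X : Type*} {H : Type*} [NormedAddCommGroup H] [InnerProductSpace ℝ H] [CompleteSpace H]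
  [RKHS ℝ H X ℝ] {n : ℕ}

variable (H) in
/-- The representers of the evaluations at the sample points. -/
noncomputable def features (S : Fin n → X × ℝ) (i : Fin n) : H := feature H (S i).1

/-- The labels of the samples. -/
def labels (S : Fin n → X × ℝ) (i : Fin n) : ℝ := (S i).2

theorem regRisk_eq_mul_objective (hn : 1 ≤ n) (lam : ℝ) (S : Fin n → X × ℝ) (k : Fin n) (f : H) :
    regRisk (lam * n) (Finset.Iio k) (features H S) (labels S) f = n * objective lam S k f := by
  have hn' : (n : ℝ) ≠ 0 := by positivity
  have hs : (Finset.univ.filter fun i => i < k) = Finset.Iio k := by ext; simp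
  rw [regRisk, objective, hs, mul_add, ← mul_assoc (n : ℝ) (1 / n), mul_one_div_cancel hn', one_mul]
  simp only [features, labels, inner_feature]
  ring

/-- For λ > 0 the minimizer is unique, so the `Classical.epsilon` choice is forced. Multiplying the
objective by n turns the weight λ into λn. -/
theorem ridge_eq_regSol (hn : 1 ≤ n) {lam : ℝ} (hl : 0 < lam) (S : Fin n → X × ℝ) (k : Fin n) :
    ridge H lam S k = regSol (lam * n) (Finset.Iio k) (features H S) (labels S) := by
  have hn' : (0 : ℝ) < n := by positivity
  have hμ : 0 < lam * n := by positivity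
  have hmin : ∀ g : H, objective lam S k
      (regSol (lam * n) (Finset.Iio k) (features H S) (labels S)) ≤ objective lam S k g := by
    intro g
    have := regRisk_regSol_le hμ (Finset.Iio k) (features H S) (labels S) g
    rw [regRisk_eq_mul_objective hn, regRisk_eq_mul_objective hn] at this
    exact le_of_mul_le_mul_left this hn'
  have huniq : ∀ f : H, (∀ g : H, objective lam S k f ≤ objective lam S k g) →
      f = regSol (lam * n) (Finset.Iio k) (features H S) (labels S) := by
    intro f hf
    refine eq_regSol_of_regRisk_le hμ _ _ _ ?_
    rw [regRisk_eq_mul_objective hn, regRisk_eq_mul_objective hn]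
    exact mul_le_mul_of_nonneg_left (hf _) hn'.le
  have hex : ∃ f : H, IsRidgeSolution lam S k f :=
    ⟨_, hmin, fun h hh => by rw [huniq h hh]⟩
  exact huniq _ (Classical.epsilon_spec hex).1

theorem ridge_update (hn : 1 ≤ n) {lam : ℝ} (hl : 0 < lam) (S : Fin n → X × ℝ) (k : Fin n)
    (p : X × ℝ) : ridge H lam (Function.update S k p) k = ridge H lam S k := by
  rw [ridge_eq_regSol hn hl, ridge_eq_regSol hn hl]
  refine regSol_congr (fun i hi => ?_) fun i hi => ?_
  · rw [features, features, Function.update_of_ne (Finset.mem_Iio.1 hi).ne]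
  · rw [labels, labels, Function.update_of_ne (Finset.mem_Iio.1 hi).ne]

variable [TopologicalSpace X]

theorem continuous_features (hF : Continuous (feature H : X → H)) (i : Fin n) :
    Continuous fun S : Fin n → X × ℝ => features H S i :=
  hF.comp (continuous_fst.comp (continuous_apply i))

theorem continuous_ridge (hF : Continuous (feature H : X → H)) (hn : 1 ≤ n) {lam : ℝ}
    (hl : 0 < lam) (k : Fin n) :
    Continuous fun S : Fin n → X × ℝ => ridge H lam S k := by
  have hμ : 0 < lam * n := by positivity
  simp_rw [ridge_eq_regSol hn hl]
  exact continuous_regSol hμ _ (continuous_features hF)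
    fun i => continuous_snd.comp (continuous_apply i)

theorem continuous_ridge_eval (hF : Continuous (feature H : X → H)) (hn : 1 ≤ n) {lam : ℝ}
    (hl : 0 < lam) (k : Fin n) :
    Continuous fun q : (Fin n → X × ℝ) × X => ridge H lam q.1 k q.2 := by
  simp_rw [← inner_feature]
  exact (hF.comp continuous_snd).inner ((continuous_ridge hF hn hl k).comp continuous_fst)

end Ridge

/-! ### From risk to sequential loss -/

section ExpectedRisk

variable {X : Type*} [TopologicalSpace X] [MeasurableSpace X] [BorelSpace X]
  [SecondCountableTopology X] {H : Type*} [NormedAddCommGroup H] [InnerProductSpace ℝ H]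
  [CompleteSpace H] [RKHS ℝ H X ℝ] {n : ℕ} {ρ : Measure (X × ℝ)} [IsProbabilityMeasure ρ] {Y : ℝ}

variable (H) in
/-- The loss on sample `k` of the truncated ridge solution for the preceding samples. -/
noncomputable def sequentialLoss (Y lam : ℝ) (k : Fin n) (S : Fin n → X × ℝ) : ℝ :=
  (truncate Y (ridge H lam S k (S k).1) - (S k).2) ^ 2

omit [TopologicalSpace X] [BorelSpace X] [SecondCountableTopology X] in
theorem ae_labels_bounded (hY : ∀ᵐ p ∂ρ, |p.2| ≤ Y) :
    ∀ᵐ S ∂(Measure.pi fun _ : Fin n => ρ), ∀ i, |(S i).2| ≤ Y := by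
  refine ae_all_iff.2 fun i => ?_
  exact (measurePreserving_eval (fun _ : Fin n => ρ) i).quasiMeasurePreserving.ae hY

theorem measurable_truncate_ridge (hF : Continuous (feature H : X → H)) (hn : 1 ≤ n) {lam : ℝ}
    (hl : 0 < lam) (hY : 0 ≤ Y) (k : Fin n) :
    Measurable fun q : (Fin n → X × ℝ) × X => truncate Y (ridge H lam q.1 k q.2) :=
  (measurable_truncate hY).comp (continuous_ridge_eval hF hn hl k).measurable

theorem measurable_sequentialLoss (hF : Continuous (feature H : X → H)) (hn : 1 ≤ n) {lam : ℝ}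
    (hl : 0 < lam) (hY : 0 ≤ Y) (k : Fin n) :
    Measurable fun S : Fin n → X × ℝ => sequentialLoss H Y lam k S := by
  have h1 : Measurable fun S : Fin n → X × ℝ => (S, (S k).1) := by fun_prop
  have h2 := (measurable_truncate_ridge hF hn hl hY k).comp h1
  exact (h2.sub (by fun_prop : Measurable fun S : Fin n → X × ℝ => (S k).2)).pow_const 2

theorem integrable_sequentialLoss (hF : Continuous (feature H : X → H)) (hn : 1 ≤ n) {lam : ℝ}
    (hl : 0 < lam) (hY : ∀ᵐ p ∂ρ, |p.2| ≤ Y) (k : Fin n) :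
    Integrable (fun S => sequentialLoss H Y lam k S) (Measure.pi fun _ => ρ) := by
  refine Integrable.of_bound (measurable_sequentialLoss hF hn hl
    (nonneg_of_label_bounded hY) k).aestronglyMeasurable (4 * Y ^ 2) ?_
  filter_upwards [ae_labels_bounded hY] with S hS
  rw [sequentialLoss, Real.norm_of_nonneg (sq_nonneg _)]
  exact truncate_sub_sq_le_const (hS k)

/-- The candidate f_k ignores sample k, so that sample can serve as the test point. -/
theorem integral_risk_truncate_ridge (hF : Continuous (feature H : X → H)) (hn : 1 ≤ n) {lam : ℝ}
    (hl : 0 < lam) (hY : ∀ᵐ p ∂ρ, |p.2| ≤ Y) (k : Fin n) :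
    Integrable (fun S : Fin n → X × ℝ => risk ρ fun x => truncate Y (ridge H lam S k x))
      (Measure.pi fun _ => ρ) ∧
    ∫ S, (risk ρ fun x => truncate Y (ridge H lam S k x)) ∂(Measure.pi fun _ : Fin n => ρ) =
      ∫ S, sequentialLoss H Y lam k S ∂(Measure.pi fun _ => ρ) := by
  have hu := measurePreserving_update ρ k
  have hi := integrable_sequentialLoss hF hn hl hY k
  have heq : ∀ q : (Fin n → X × ℝ) × (X × ℝ),
      sequentialLoss H Y lam k (Function.update q.1 k q.2) =
        (truncate Y (ridge H lam q.1 k q.2.1) - q.2.2) ^ 2 := by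
    intro q
    rw [sequentialLoss, ridge_update hn hl, Function.update_self]
  have hi2 : Integrable (fun q : (Fin n → X × ℝ) × (X × ℝ) =>
      (truncate Y (ridge H lam q.1 k q.2.1) - q.2.2) ^ 2)
      ((Measure.pi fun _ => ρ).prod ρ) := by
    simp_rw [← heq]
    exact hu.integrable_comp_of_integrable hi
  refine ⟨hi2.integral_prod_left, ?_⟩
  calc _ = ∫ q, (truncate Y (ridge H lam q.1 k q.2.1) - q.2.2) ^ 2
        ∂((Measure.pi fun _ : Fin n => ρ).prod ρ) := (integral_prod _ hi2).symm
    _ = ∫ q, sequentialLoss H Y lam k (Function.update q.1 k q.2)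
        ∂((Measure.pi fun _ : Fin n => ρ).prod ρ) := by simp_rw [heq]
    _ = _ := by
      conv_rhs => rw [← hu.map_eq]
      rw [integral_map hu.measurable.aemeasurable]
      rw [hu.map_eq]
      exact hi.1

/-- Each permutation preserves the law of the sample, so all terms of the average over permutations
have the same expectation. -/
theorem integral_averageRisk (hF : Continuous (feature H : X → H)) (hn : 1 ≤ n) {lam : ℝ}
    (hl : 0 < lam) (hY : ∀ᵐ p ∂ρ, |p.2| ≤ Y) :
    Integrable (fun S : Fin n → X × ℝ => averageRisk H ρ Y lam S) (Measure.pi fun _ => ρ) ∧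
    ∫ S, averageRisk H ρ Y lam S ∂(Measure.pi fun _ : Fin n => ρ) =
      1 / n * ∫ S, ∑ k, sequentialLoss H Y lam k S ∂(Measure.pi fun _ : Fin n => ρ) := by
  have h := integral_risk_truncate_ridge (ρ := ρ) (Y := Y) (n := n) (H := H) hF hn hl hY
  have hi : ∀ (σ : Equiv.Perm (Fin n)) (k : Fin n), Integrable (fun S : Fin n → X × ℝ =>
      risk ρ fun x => truncate Y (ridge H lam (S ∘ σ) k x)) (Measure.pi fun _ => ρ) := fun σ k =>
    (measurePreserving_comp_perm ρ σ).integrable_comp_of_integrable (h k).1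
  have hi2 : ∀ σ : Equiv.Perm (Fin n), Integrable (fun S : Fin n → X × ℝ =>
      (1 / (n : ℝ)) * ∑ k : Fin n, risk ρ fun x => truncate Y (ridge H lam (S ∘ σ) k x))
      (Measure.pi fun _ => ρ) := fun σ =>
    (integrable_finsetSum _ fun k _ => hi σ k).const_mul _
  refine ⟨(integrable_finsetSum _ fun σ _ => hi2 σ).const_mul _, ?_⟩
  have h3 : ∀ (σ : Equiv.Perm (Fin n)) (k : Fin n),
      ∫ S, (risk ρ fun x => truncate Y (ridge H lam (S ∘ σ) k x))
        ∂(Measure.pi fun _ : Fin n => ρ) =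
      ∫ S, sequentialLoss H Y lam k S ∂(Measure.pi fun _ => ρ) := by
    intro σ k
    rw [← (h k).2]
    have hσ := measurePreserving_comp_perm ρ σ
    conv_rhs => rw [← hσ.map_eq]
    rw [integral_map hσ.measurable.aemeasurable]
    rw [hσ.map_eq]
    exact (h k).1.1
  unfold averageRisk
  rw [integral_const_mul, integral_finsetSum _ fun σ _ => hi2 σ]
  simp_rw [integral_const_mul]
  have h4 : ∀ σ : Equiv.Perm (Fin n), ∫ S, (∑ k, risk ρ fun x =>
      truncate Y (ridge H lam (S ∘ σ) k x)) ∂(Measure.pi fun _ : Fin n => ρ) =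
      ∫ S, ∑ k, sequentialLoss H Y lam k S ∂(Measure.pi fun _ : Fin n => ρ) := by
    intro σ
    rw [integral_finsetSum _ fun k _ => hi σ k,
      integral_finsetSum _ fun k _ => integrable_sequentialLoss hF hn hl hY k]
    exact Finset.sum_congr rfl fun k _ => h3 σ k
  simp_rw [h4]
  rw [Finset.sum_const, Finset.card_univ, Fintype.card_perm, Fintype.card_fin, nsmul_eq_mul,
    ← mul_assoc, one_div_mul_cancel (by positivity), one_mul]

end ExpectedRisk

/-- Tangent line at a of the concave function x/(x + μ). Being affine in x, it gives Jensen's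
inequality by plain integration or summation. -/
theorem div_add_le_tangent {x a μ : ℝ} (hx : 0 ≤ x) (ha : 0 ≤ a) (hμ : 0 < μ) :
    x / (x + μ) ≤ (a ^ 2 + μ * x) / (a + μ) ^ 2 := by
  rw [div_le_div_iff₀ (by positivity) (by positivity)]
  nlinarith [mul_nonneg hμ.le (sq_nonneg (a - x))]

/-! ### Expected leverage scores -/

section ExpectedLeverage

variable {X : Type*} [TopologicalSpace X] [MeasurableSpace X] [BorelSpace X]
  [SecondCountableTopology X] {H : Type*} [NormedAddCommGroup H] [InnerProductSpace ℝ H]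
  [CompleteSpace H] [RKHS ℝ H X ℝ] {n : ℕ} {ρ : Measure (X × ℝ)} [IsProbabilityMeasure ρ] {Y : ℝ}

omit [TopologicalSpace X] [MeasurableSpace X] [BorelSpace X] [SecondCountableTopology X] in
theorem abs_apply_le_norm (hF1 : ∀ x, ‖feature H x‖ ≤ 1) (f : H) (x : X) : |f x| ≤ ‖f‖ := by
  rw [← inner_feature]
  exact (abs_real_inner_le_norm _ _).trans (mul_le_of_le_one_left (norm_nonneg _) (hF1 x))

omit [TopologicalSpace X] [BorelSpace X] [SecondCountableTopology X] in
theorem integral_comp_eval {f : X → ℝ} (hf : Measurable f) (j : Fin n) :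
    ∫ S, f (S j).1 ∂(Measure.pi fun _ : Fin n => ρ) = ∫ x, f x ∂ρ.fst := by
  have he := measurePreserving_eval (fun _ : Fin n => ρ) j
  rw [integral_fst hf.aestronglyMeasurable]
  conv_rhs => rw [← he.map_eq]
  exact (integral_map he.measurable.aemeasurable
    (hf.comp measurable_fst).aestronglyMeasurable).symm

/-- Jensen's inequality, through the tangent line at the mean `a` of the sum of squares. -/
theorem lintegral_div_add_le (hF : Continuous (feature H : X → H))
    (hF1 : ∀ x, ‖feature H x‖ ≤ 1) {μ : ℝ} (hμ : 0 < μ) (u : H) (s : Finset (Fin n)) :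
    ∫⁻ S, ENNReal.ofReal ((∑ j ∈ s, ⟪features H S j, u⟫_ℝ ^ 2) /
        ((∑ j ∈ s, ⟪features H S j, u⟫_ℝ ^ 2) + μ)) ∂(Measure.pi fun _ : Fin n => ρ) ≤
      ENNReal.ofReal ((s.card * ∫ x, u x ^ 2 ∂ρ.fst) /
        ((s.card * ∫ x, u x ^ 2 ∂ρ.fst) + μ)) := by
  have hu : Continuous fun x => u x := continuous_rkhs hF u
  set a := s.card * ∫ x, u x ^ 2 ∂ρ.fst with ha
  have ha0 : 0 ≤ a := mul_nonneg (Nat.cast_nonneg _) (integral_nonneg fun _ => sq_nonneg _)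
  have hx0 : ∀ S : Fin n → X × ℝ, 0 ≤ ∑ j ∈ s, ⟪features H S j, u⟫_ℝ ^ 2 := fun S =>
    Finset.sum_nonneg fun _ _ => sq_nonneg _
  have hij : ∀ j, Integrable (fun S : Fin n → X × ℝ => ⟪features H S j, u⟫_ℝ ^ 2)
      (Measure.pi fun _ : Fin n => ρ) := by
    intro j
    have hm : Measurable fun S : Fin n → X × ℝ => ⟪features H S j, u⟫_ℝ ^ 2 :=
      (((continuous_features (n := n) hF j).inner (𝕜 := ℝ)
        (continuous_const (y := u))).pow 2).measurable
    refine Integrable.of_bound hm.aestronglyMeasurable (‖u‖ ^ 2)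
      (Filter.Eventually.of_forall fun S => ?_)
    rw [norm_pow]
    gcongr
    rw [features, inner_feature]
    exact abs_apply_le_norm hF1 u _
  have hi : Integrable (fun S : Fin n → X × ℝ =>
      (a ^ 2 + μ * ∑ j ∈ s, ⟪features H S j, u⟫_ℝ ^ 2) / (a + μ) ^ 2)
      (Measure.pi fun _ : Fin n => ρ) :=
    ((integrable_const _).add ((integrable_finsetSum _ fun j _ => hij j).const_mul μ)).div_const _
  have hE : ∫ S, (a ^ 2 + μ * ∑ j ∈ s, ⟪features H S j, u⟫_ℝ ^ 2) / (a + μ) ^ 2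
      ∂(Measure.pi fun _ : Fin n => ρ) = a / (a + μ) := by
    rw [integral_div, integral_add (integrable_const _)
      ((integrable_finsetSum _ fun j _ => hij j).const_mul μ), integral_const_mul,
      integral_finsetSum _ fun j _ => hij j]
    have : ∀ j, ∫ S, ⟪features H S j, u⟫_ℝ ^ 2 ∂(Measure.pi fun _ : Fin n => ρ) =
        ∫ x, u x ^ 2 ∂ρ.fst := by
      intro j
      simp_rw [features, inner_feature]
      exact integral_comp_eval (f := fun x => u x ^ 2) (hu.pow 2).measurable j
    simp_rw [this]
    rw [Finset.sum_const, nsmul_eq_mul, ← ha]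
    have : a + μ ≠ 0 := by positivity
    simp
    field_simp
  rw [← hE, ofReal_integral_eq_lintegral_ofReal hi
    (Filter.Eventually.of_forall fun S => by have := hx0 S; positivity)]
  exact lintegral_mono fun S => ENNReal.ofReal_le_ofReal (div_add_le_tangent (hx0 S) ha0 hμ)

/-- The k + 1 points indexed by `Finset.Iic k` are exchangeable, so the last score has 1/(k + 1) of
the expected total, and the total is bounded through `sum_leverage_le`. -/
theorem lintegral_leverage_le (hF : Continuous (feature H : X → H))
    (hF1 : ∀ x, ‖feature H x‖ ≤ 1) {μ : ℝ} (hμ : 0 < μ) {κ : Type*} [Countable κ]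
    (e : HilbertBasis κ ℝ H) {ν : κ → ℝ} (hν : ∀ i, ∫ x, e i x ^ 2 ∂ρ.fst = ν i) (k : Fin n) :
    ∫⁻ S, ENNReal.ofReal (leverage μ (Finset.Iic k) (features H S) k)
        ∂(Measure.pi fun _ : Fin n => ρ) ≤
      ∑' i, ENNReal.ofReal (ν i / ((k.val + 1 : ℕ) * ν i + μ)) := by
  have hm : ∀ j, Measurable fun S : Fin n → X × ℝ =>
      ENNReal.ofReal (leverage μ (Finset.Iic k) (features H S) j) := fun j =>
    (continuous_leverage hμ _ (continuous_features hF) j).measurable.ennreal_ofReal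
  have hswap : ∀ j ∈ Finset.Iic k, ∫⁻ S, ENNReal.ofReal
      (leverage μ (Finset.Iic k) (features H S) j) ∂(Measure.pi fun _ : Fin n => ρ) =
      ∫⁻ S, ENNReal.ofReal (leverage μ (Finset.Iic k) (features H S) k)
        ∂(Measure.pi fun _ : Fin n => ρ) := by
    intro j hj
    have hj' := Finset.mem_Iic.1 hj
    have hσ := measurePreserving_comp_perm ρ (Equiv.swap j k)
    have hmem : ∀ i, i ∈ Finset.Iic k ↔ Equiv.swap j k i ∈ Finset.Iic k := by
      intro i
      rw [Finset.mem_Iic, Finset.mem_Iic]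
      rcases eq_or_ne i j with rfl | h1
      · rw [Equiv.swap_apply_left]; exact ⟨fun _ => le_rfl, fun _ => hj'⟩
      · rcases eq_or_ne i k with rfl | h2
        · rw [Equiv.swap_apply_right]; exact ⟨fun _ => hj', fun _ => le_rfl⟩
        · rw [Equiv.swap_apply_of_ne_of_ne h1 h2]
    rw [← hσ.lintegral_comp (hm j)]
    refine lintegral_congr fun S => ?_
    have h := leverage_comp_perm μ (Equiv.swap j k) hmem (features H S) j
    rw [Equiv.swap_apply_left] at h
    rw [← h]
    rfl
  have hsum : ((k.val + 1 : ℕ) : ℝ≥0∞) * ∫⁻ S, ENNReal.ofReal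
      (leverage μ (Finset.Iic k) (features H S) k) ∂(Measure.pi fun _ : Fin n => ρ) ≤
      ∑' i, ENNReal.ofReal (((k.val + 1 : ℕ) * ν i) / ((k.val + 1 : ℕ) * ν i + μ)) := by
    calc _ = ∑ j ∈ Finset.Iic k, ∫⁻ S, ENNReal.ofReal
          (leverage μ (Finset.Iic k) (features H S) j) ∂(Measure.pi fun _ : Fin n => ρ) := by
          rw [Finset.sum_congr rfl hswap, Finset.sum_const, nsmul_eq_mul, Fin.card_Iic]
      _ = ∫⁻ S, ENNReal.ofReal (∑ j ∈ Finset.Iic k, leverage μ (Finset.Iic k) (features H S) j)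
          ∂(Measure.pi fun _ : Fin n => ρ) := by
          rw [← lintegral_finsetSum _ fun j _ => hm j]
          refine lintegral_congr fun S => ?_
          rw [ENNReal.ofReal_sum_of_nonneg fun j _ => leverage_nonneg hμ _ _ _]
      _ ≤ ∫⁻ S, ∑' i, ENNReal.ofReal ((∑ j ∈ Finset.Iic k, ⟪features H S j, e i⟫_ℝ ^ 2) /
            ((∑ j ∈ Finset.Iic k, ⟪features H S j, e i⟫_ℝ ^ 2) + μ))
            ∂(Measure.pi fun _ : Fin n => ρ) :=
          lintegral_mono fun S => sum_leverage_le e hμ _ _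
      _ = ∑' i, ∫⁻ S, ENNReal.ofReal ((∑ j ∈ Finset.Iic k, ⟪features H S j, e i⟫_ℝ ^ 2) /
            ((∑ j ∈ Finset.Iic k, ⟪features H S j, e i⟫_ℝ ^ 2) + μ))
            ∂(Measure.pi fun _ : Fin n => ρ) := by
          refine lintegral_tsum fun i => Measurable.aemeasurable ?_
          have hc : Measurable fun S : Fin n → X × ℝ =>
              ∑ j ∈ Finset.Iic k, ⟪features H S j, e i⟫_ℝ ^ 2 :=
            (continuous_finsetSum _ fun j _ => ((continuous_features (n := n) hF j).inner
              (continuous_const (y := e i))).pow 2).measurable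
          exact (hc.div (hc.add_const μ)).ennreal_ofReal
      _ ≤ _ := by
          refine ENNReal.tsum_le_tsum fun i => ?_
          have := lintegral_div_add_le (ρ := ρ) hF hF1 hμ (e i) (Finset.Iic k)
          rwa [hν, Fin.card_Iic] at this
  have hk0 : ((k.val + 1 : ℕ) : ℝ≥0∞) ≠ 0 := by simp
  have hktop : ((k.val + 1 : ℕ) : ℝ≥0∞) ≠ ⊤ := ENNReal.natCast_ne_top _
  rw [← ENNReal.mul_le_mul_iff_right hk0 hktop, ← ENNReal.tsum_mul_left]
  refine hsum.trans (le_of_eq (tsum_congr fun i => ?_))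
  rw [mul_div_assoc, ENNReal.ofReal_mul (by positivity), ENNReal.ofReal_natCast]

end ExpectedLeverage

/-! ### Two risk bounds against an arbitrary competitor -/

section ExcessRisk

variable {X : Type*} [TopologicalSpace X] [MeasurableSpace X] [BorelSpace X]
  [SecondCountableTopology X] {H : Type*} [NormedAddCommGroup H] [InnerProductSpace ℝ H]
  [CompleteSpace H] [RKHS ℝ H X ℝ] {n : ℕ} {ρ : Measure (X × ℝ)} [IsProbabilityMeasure ρ] {Y : ℝ}

omit [SecondCountableTopology X] in
theorem integral_regRisk (hF : Continuous (feature H : X → H))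
    (hF1 : ∀ x, ‖feature H x‖ ≤ 1) (hY : ∀ᵐ p ∂ρ, |p.2| ≤ Y) (μ : ℝ) (f : H) :
    Integrable (fun S => regRisk μ Finset.univ (features H S) (labels S) f)
      (Measure.pi fun _ : Fin n => ρ) ∧
    ∫ S, regRisk μ Finset.univ (features H S) (labels S) f ∂(Measure.pi fun _ : Fin n => ρ) =
      μ * ‖f‖ ^ 2 + n * risk ρ fun x => f x := by
  have hf : Measurable fun x => f x := (continuous_rkhs hF f).measurable
  have h1 : Integrable (fun p : X × ℝ => (f p.1 - p.2) ^ 2) ρ := by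
    refine Integrable.of_bound (by fun_prop) ((‖f‖ + Y) ^ 2) ?_
    filter_upwards [hY] with p hp
    rw [norm_pow]
    gcongr
    exact (abs_sub _ _).trans (add_le_add (abs_apply_le_norm hF1 f _) hp)
  have he := fun j => measurePreserving_eval (fun _ : Fin n => ρ) j
  have h2 : ∀ j, Integrable (fun S : Fin n → X × ℝ => (f (S j).1 - (S j).2) ^ 2)
      (Measure.pi fun _ : Fin n => ρ) := fun j => (he j).integrable_comp_of_integrable h1
  have h3 : ∀ j, ∫ S, (f (S j).1 - (S j).2) ^ 2 ∂(Measure.pi fun _ : Fin n => ρ) =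
      risk ρ fun x => f x := by
    intro j
    rw [risk]
    conv_rhs => rw [← (he j).map_eq]
    rw [integral_map (he j).measurable.aemeasurable (by fun_prop)]
  simp only [regRisk, features, labels, inner_feature]
  refine ⟨(integrable_const _).add (integrable_finsetSum _ fun j _ => h2 j), ?_⟩
  rw [integral_add (integrable_const _) (integrable_finsetSum _ fun j _ => h2 j),
    integral_finsetSum _ fun j _ => h2 j]
  simp [h3]

omit [TopologicalSpace X] [MeasurableSpace X] [BorelSpace X] [SecondCountableTopology X] in
theorem sequentialLoss_le (hn : 1 ≤ n) {lam : ℝ} (hl : 0 < lam) {S : Fin n → X × ℝ}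
    (hS : ∀ i, |(S i).2| ≤ Y) (k : Fin n) :
    sequentialLoss H Y lam k S ≤
      (⟪features H S k, regSol (lam * n) (Finset.Iio k) (features H S) (labels S)⟫_ℝ -
        labels S k) ^ 2 := by
  rw [sequentialLoss, ridge_eq_regSol hn hl, features, inner_feature]
  exact truncate_sub_sq_le (hS k)

theorem integrable_leverage (hF : Continuous (feature H : X → H))
    (hF1 : ∀ x, ‖feature H x‖ ≤ 1) {μ : ℝ} (hμ : 0 < μ) (k : Fin n) :
    Integrable (fun S => leverage μ (Finset.Iic k) (features H S) k)
      (Measure.pi fun _ : Fin n => ρ) := by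
  refine Integrable.of_bound (continuous_leverage hμ _
    (continuous_features hF) k).measurable.aestronglyMeasurable 1
    (Filter.Eventually.of_forall fun S => ?_)
  rw [Real.norm_of_nonneg (leverage_nonneg hμ _ _ _)]
  exact leverage_le_one hμ (Finset.mem_Iic.2 le_rfl) (hF1 _)

/-- The risk bound in terms of the expected leverage scores. -/
theorem integral_averageRisk_le_leverage (hF : Continuous (feature H : X → H))
    (hF1 : ∀ x, ‖feature H x‖ ≤ 1) (hn : 1 ≤ n) {lam : ℝ} (hl : 0 < lam)
    (hY : ∀ᵐ p ∂ρ, |p.2| ≤ Y) {Q : ℝ} (hQ0 : 0 ≤ Q)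
    (hQ : ∑ k : Fin n, ∫⁻ S, ENNReal.ofReal
      (leverage (lam * n) (Finset.Iic k) (features H S) k) ∂(Measure.pi fun _ : Fin n => ρ) ≤
      ENNReal.ofReal Q) (f : H) :
    ∫ S, averageRisk H ρ Y lam S ∂(Measure.pi fun _ : Fin n => ρ) ≤
      (lam * ‖f‖ ^ 2 + risk ρ fun x => f x) + 4 * Y ^ 2 * Q / n := by
  have hn' : (0 : ℝ) < n := by positivity
  have hμ : 0 < lam * n := by positivity
  have hint := fun k : Fin n => integrable_leverage (ρ := ρ) hF hF1 hμ k
  have hreg := integral_regRisk (n := n) hF hF1 hY (lam * n) f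
  have hEQ : ∫ S, ∑ k, leverage (lam * n) (Finset.Iic k) (features H S) k
      ∂(Measure.pi fun _ : Fin n => ρ) ≤ Q := by
    rw [integral_finsetSum _ fun k _ => hint k, ← ENNReal.ofReal_le_ofReal_iff hQ0,
      ENNReal.ofReal_sum_of_nonneg fun k _ => integral_nonneg fun S => leverage_nonneg hμ _ _ _]
    refine le_trans (le_of_eq (Finset.sum_congr rfl fun k _ => ?_)) hQ
    exact ofReal_integral_eq_lintegral_ofReal (hint k)
      (Filter.Eventually.of_forall fun S => leverage_nonneg hμ _ _ _)
  -- With h the leverage, split each loss as (1 - h) loss + h loss. The sequential inequality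
  -- controls the first part, truncation bounds the second by 4Y²h.
  have hpt : ∀ᵐ S ∂(Measure.pi fun _ : Fin n => ρ), ∑ k, sequentialLoss H Y lam k S ≤
      regRisk (lam * n) Finset.univ (features H S) (labels S) f +
        4 * Y ^ 2 * ∑ k, leverage (lam * n) (Finset.Iic k) (features H S) k := by
    filter_upwards [ae_labels_bounded hY] with S hS
    have h := sum_sq_mul_le_regRisk hμ (features H S) (labels S) f
    rw [Finset.mul_sum]
    refine le_trans ?_ (add_le_add_left h _)
    rw [← Finset.sum_add_distrib]
    refine Finset.sum_le_sum fun k _ => ?_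
    have h1 := leverage_nonneg hμ (Finset.Iic k) (features H S) k
    have h2 := leverage_le_one hμ (k := features H S) (Finset.mem_Iic.2 (le_refl k)) (hF1 _)
    have h3 : sequentialLoss H Y lam k S ≤ 4 * Y ^ 2 := truncate_sub_sq_le_const (hS k)
    have h4 := sequentialLoss_le (H := H) hn hl hS k
    nlinarith [mul_le_mul_of_nonneg_right h3 h1,
      mul_le_mul_of_nonneg_right h4 (sub_nonneg.2 h2)]
  rw [(integral_averageRisk hF hn hl hY).2]
  have hfin := integral_mono_ae (integrable_finsetSum _ fun k _ =>
    integrable_sequentialLoss hF hn hl hY k)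
    (hreg.1.add ((integrable_finsetSum _ fun k _ => hint k).const_mul (4 * Y ^ 2))) hpt
  simp only [Pi.add_apply] at hfin
  rw [integral_add hreg.1 ((integrable_finsetSum _ fun k _ => hint k).const_mul (4 * Y ^ 2)),
    hreg.2, integral_const_mul] at hfin
  have h5 : 4 * Y ^ 2 * ∫ S, ∑ k, leverage (lam * n) (Finset.Iic k) (features H S) k
      ∂(Measure.pi fun _ : Fin n => ρ) ≤ 4 * Y ^ 2 * Q := by gcongr
  calc 1 / (n : ℝ) * ∫ S, ∑ k, sequentialLoss H Y lam k S ∂(Measure.pi fun _ : Fin n => ρ)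
      ≤ 1 / (n : ℝ) * (lam * n * ‖f‖ ^ 2 + n * (risk ρ fun x => f x) + 4 * Y ^ 2 * Q) := by
        gcongr
        linarith
    _ = _ := by field_simp

/-- The risk bound for small noise. -/
theorem integral_averageRisk_le_mul (hF : Continuous (feature H : X → H))
    (hF1 : ∀ x, ‖feature H x‖ ≤ 1) (hn : 1 ≤ n) {lam : ℝ} (hl : 0 < lam)
    (hY : ∀ᵐ p ∂ρ, |p.2| ≤ Y) (f : H) :
    ∫ S, averageRisk H ρ Y lam S ∂(Measure.pi fun _ : Fin n => ρ) ≤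
      (1 + 1 / (lam * n)) * (lam * ‖f‖ ^ 2 + risk ρ fun x => f x) := by
  have hn' : (0 : ℝ) < n := by positivity
  have hμ : 0 < lam * n := by positivity
  have hreg := integral_regRisk (n := n) hF hF1 hY (lam * n) f
  have hpt : ∀ᵐ S ∂(Measure.pi fun _ : Fin n => ρ), ∑ k, sequentialLoss H Y lam k S ≤
      (1 + 1 / (lam * n)) * regRisk (lam * n) Finset.univ (features H S) (labels S) f := by
    filter_upwards [ae_labels_bounded hY] with S hS
    have h := sum_sq_mul_le_regRisk hμ (features H S) (labels S) f
    refine le_trans ?_ (mul_le_mul_of_nonneg_left h (by positivity))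
    rw [Finset.mul_sum]
    refine Finset.sum_le_sum fun k _ => (sequentialLoss_le (H := H) hn hl hS k).trans ?_
    have h1 := leverage_mul_le hμ (k := features H S) (Finset.mem_Iic.2 (le_refl k)) (hF1 _)
    -- Here h ≤ 1/(1 + μ) is rewritten as (1 + 1/μ)(1 - h) ≥ 1 with μ = λn.
    have h2 : 1 ≤ (1 + 1 / (lam * n)) *
        (1 - leverage (lam * n) (Finset.Iic k) (features H S) k) := by
      have h3 : 1 + 1 / (lam * n) = (1 + lam * n) / (lam * n) := by
        field_simp
        ring
      rw [h3, div_mul_eq_mul_div, le_div_iff₀ hμ]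
      linarith
    have h4 := mul_le_mul_of_nonneg_left h2 (sq_nonneg (⟪features H S k,
      regSol (lam * n) (Finset.Iio k) (features H S) (labels S)⟫_ℝ - labels S k))
    linarith
  rw [(integral_averageRisk hF hn hl hY).2]
  have hfin := integral_mono_ae (integrable_finsetSum _ fun k _ =>
    integrable_sequentialLoss hF hn hl hY k) (hreg.1.const_mul (1 + 1 / (lam * n))) hpt
  rw [integral_const_mul, hreg.2] at hfin
  calc 1 / (n : ℝ) * ∫ S, ∑ k, sequentialLoss H Y lam k S ∂(Measure.pi fun _ : Fin n => ρ)
      ≤ 1 / (n : ℝ) * ((1 + 1 / (lam * n)) *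
          (lam * n * ‖f‖ ^ 2 + n * risk ρ fun x => f x)) := by gcongr
    _ = _ := by field_simp

end ExcessRisk

/-! ### Competitors under the source condition -/

section SourceCondition

variable {X : Type*} [TopologicalSpace X] [CompactSpace X] [MeasurableSpace X] [BorelSpace X]
  [SecondCountableTopology X] {H : Type*} [NormedAddCommGroup H] [InnerProductSpace ℝ H]
  [CompleteSpace H] [RKHS ℝ H X ℝ] {n : ℕ} {ρ : Measure (X × ℝ)} [IsProbabilityMeasure ρ] {Y : ℝ}

omit [SecondCountableTopology X] in
theorem risk_eq_norm_sq_add_bayesRisk (hF : Continuous (feature H : X → H))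
    (hF1 : ∀ x, ‖feature H x‖ ≤ 1) (hY : ∀ᵐ p ∂ρ, |p.2| ≤ Y) {f : Lp ℝ 2 ρ.fst}
    (hf : f =ᵐ[ρ.fst] regressionFunction ρ) (u : H) :
    (risk ρ fun x => u x) = ‖embed ρ.fst hF u - f‖ ^ 2 + bayesRisk ρ := by
  rw [risk_eq_add_bayesRisk hY (continuous_rkhs hF u).measurable (abs_apply_le_norm hF1 u)]
  congr 1
  rw [← real_inner_self_eq_norm_sq, L2.inner_def]
  refine integral_congr_ae ?_
  filter_upwards [hf, embed_ae_eq ρ.fst hF u, Lp.coeFn_sub (embed ρ.fst hF u) f] with x h1 h2 h3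
  rw [h3, Pi.sub_apply, h1, h2, real_inner_self_eq_norm_sq, Real.norm_eq_abs, sq_abs]

omit [SecondCountableTopology X] in
theorem excess_le_of_forall {K : C(X × X, ℝ)}
    (hK : ∀ x x' : X, RKHS.kernel H x x' 1 = K (x, x')) (hF1 : ∀ x, ‖feature H x‖ ≤ 1)
    (hY : ∀ᵐ p ∂ρ, |p.2| ≤ Y) {β lam : ℝ} (hβ : 0 < β) (hβ' : β ≤ 1 / 2) (hl : 0 < lam)
    {f g : Lp ℝ 2 ρ.fst} (hf : f =ᵐ[ρ.fst] regressionFunction ρ)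
    (hfg : IsPowApply (integralOperator K ρ.fst) β g f) {B c d : ℝ} (hc : 0 ≤ c)
    (hB : ∀ u : H, B ≤ c * (lam * ‖u‖ ^ 2 + risk ρ fun x => u x) + d) :
    B ≤ c * (lam ^ (2 * β) * ‖g‖ ^ 2 + bayesRisk ρ) + d := by
  have h := le_of_forall_penalized (embed (H := H) ρ.fst (continuous_feature hK))
    (embed_adjoint_embed ρ.fst hK) (d := c * bayesRisk ρ + d) (B := B) hβ hβ' hl hc hfg
    (fun u => by
      have := hB u
      rw [risk_eq_norm_sq_add_bayesRisk (continuous_feature hK) hF1 hY hf u] at this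
      linarith)
  linarith

end SourceCondition

/-! ### Effective dimension sums -/

section EffectiveDimension

/-- Weighted AM-GM: (tν)^(1-b) μ^b ≤ tν + μ. -/
theorem div_mul_add_le_rpow {b ν μ t : ℝ} (hb : 0 < b) (hb' : b ≤ 1) (hν : 0 < ν) (hμ : 0 < μ)
    (ht : 0 < t) : ν / (t * ν + μ) ≤ t ^ (b - 1) * μ ^ (-b) * ν ^ b := by
  have h := Real.geom_mean_le_arith_mean2_weighted (w₁ := 1 - b) (w₂ := b) (by linarith) hb.le
    (p₁ := t * ν) (p₂ := μ) (by positivity) hμ.le (by ring)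
  have h2 : (t * ν) ^ (1 - b) * μ ^ b ≤ t * ν + μ := by
    have : 0 < t * ν := by positivity
    nlinarith
  rw [div_le_iff₀ (by positivity)]
  have h3 : t ^ (b - 1) * μ ^ (-b) * ν ^ b * ((t * ν) ^ (1 - b) * μ ^ b) = ν := by
    rw [Real.mul_rpow ht.le hν.le]
    calc t ^ (b - 1) * μ ^ (-b) * ν ^ b * (t ^ (1 - b) * ν ^ (1 - b) * μ ^ b)
        = (t ^ (b - 1) * t ^ (1 - b)) * (μ ^ (-b) * μ ^ b) * (ν ^ b * ν ^ (1 - b)) := by ring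
      _ = ν := by
        rw [← Real.rpow_add ht, ← Real.rpow_add hμ, ← Real.rpow_add hν]
        simp
  calc ν = t ^ (b - 1) * μ ^ (-b) * ν ^ b * ((t * ν) ^ (1 - b) * μ ^ b) := h3.symm
    _ ≤ _ := by gcongr

/-- With t = n + 1, Bernoulli's inequality for (1 - 1/t)^b gives t^(b-1) ≤ (t^b - n^b)/b, which
telescopes. -/
theorem sum_rpow_le {b : ℝ} (hb : 0 < b) (hb' : b ≤ 1) (n : ℕ) :
    ∑ k ∈ Finset.range n, ((k + 1 : ℕ) : ℝ) ^ (b - 1) ≤ (n : ℝ) ^ b / b := by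
  induction n with
  | zero => simp [Real.zero_rpow hb.ne']
  | succ n ih =>
    rw [Finset.sum_range_succ]
    have ht : (0 : ℝ) < (n + 1 : ℕ) := by positivity
    set t : ℝ := ((n + 1 : ℕ) : ℝ) with htdef
    have hn : (n : ℝ) = t * (1 + -(1 / t)) := by
      field_simp
      rw [htdef]
      push_cast
      ring
    have h1t : 1 / t ≤ 1 := by
      rw [div_le_one ht, htdef]
      push_cast
      linarith [Nat.cast_nonneg (α := ℝ) n]
    have h := rpow_one_add_le_one_add_mul_self (s := -(1 / t)) (by linarith) hb.le hb'
    have h2 : (n : ℝ) ^ b ≤ t ^ b * (1 + b * -(1 / t)) := by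
      rw [hn, Real.mul_rpow ht.le (by linarith)]
      gcongr
    have h3 : t ^ (b - 1) = t ^ b / t := by rw [Real.rpow_sub ht, Real.rpow_one]
    have h4 : (n : ℝ) ^ b / b ≤ t ^ b * (1 + b * -(1 / t)) / b := by gcongr
    have h5 : t ^ b * (1 + b * -(1 / t)) / b = t ^ b / b - t ^ b / t := by
      field_simp
      ring
    rw [h3]
    linarith

/-- Telescoping from 1/(m + n + 1) ≤ log(m + n + 1) - log(m + n). -/
theorem sum_div_add_le_log {m : ℝ} (hm : 0 < m) (n : ℕ) :
    ∑ k ∈ Finset.range n, m / (((k + 1 : ℕ) : ℝ) + m) ≤ m * Real.log (1 + n / m) := by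
  induction n with
  | zero => simp
  | succ n ih =>
    rw [Finset.sum_range_succ]
    have hn : (0 : ℝ) ≤ n := Nat.cast_nonneg n
    have h1 : (1 : ℝ) + n / m = (m + n) / m := by field_simp
    have h2 : (1 : ℝ) + ((n + 1 : ℕ) : ℝ) / m = (m + n + 1) / m := by
      push_cast
      field_simp
      ring
    have h3 : Real.log ((m + n) / (m + n + 1)) ≤ (m + n) / (m + n + 1) - 1 :=
      Real.log_le_sub_one_of_pos (by positivity)
    rw [Real.log_div (by positivity) (by positivity)] at h3
    rw [h1, Real.log_div (by positivity) hm.ne'] at ih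
    rw [h2, Real.log_div (by positivity) hm.ne']
    have h4 : (m + n) / (m + n + 1) - 1 = -(1 / (m + n + 1)) := by
      field_simp
      ring
    have h5 : m / (((n + 1 : ℕ) : ℝ) + m) = m * (1 / (m + n + 1)) := by
      push_cast
      rw [mul_one_div]
      congr 1
      ring
    rw [h5]
    rw [h4] at h3
    nlinarith

variable {κ : Type*} {ν : κ → ℝ}

theorem sum_tsum_le_of_tsum_rpow_le (hν : ∀ i, 0 < ν i) {b μ T : ℝ} (hb : 0 < b) (hb' : b ≤ 1)
    (hμ : 0 < μ) (hT0 : 0 ≤ T) (hT : ∑' i, ENNReal.ofReal (ν i ^ b) ≤ ENNReal.ofReal T) (n : ℕ) :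
    ∑ k : Fin n, ∑' i, ENNReal.ofReal (ν i / ((k.val + 1 : ℕ) * ν i + μ)) ≤
      ENNReal.ofReal (n ^ b / b * μ ^ (-b) * T) := by
  rw [Fin.sum_univ_eq_sum_range
    (fun k => ∑' i, ENNReal.ofReal (ν i / ((k + 1 : ℕ) * ν i + μ))) n]
  have h1 : ∀ k : ℕ, ∑' i, ENNReal.ofReal (ν i / ((k + 1 : ℕ) * ν i + μ)) ≤
      ENNReal.ofReal (((k + 1 : ℕ) : ℝ) ^ (b - 1) * μ ^ (-b) * T) := by
    intro k
    have ht : (0 : ℝ) < (k + 1 : ℕ) := by positivity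
    calc _ ≤ ∑' i, ENNReal.ofReal (((k + 1 : ℕ) : ℝ) ^ (b - 1) * μ ^ (-b)) *
          ENNReal.ofReal (ν i ^ b) := by
          refine ENNReal.tsum_le_tsum fun i => ?_
          rw [← ENNReal.ofReal_mul (by positivity)]
          exact ENNReal.ofReal_le_ofReal (div_mul_add_le_rpow hb hb' (hν i) hμ ht)
      _ ≤ _ := by
          rw [ENNReal.tsum_mul_left, ENNReal.ofReal_mul (p := _ * _) (by positivity)]
          gcongr
  refine (Finset.sum_le_sum fun k _ => h1 k).trans ?_
  rw [← ENNReal.ofReal_sum_of_nonneg fun k _ => by positivity]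
  refine ENNReal.ofReal_le_ofReal ?_
  rw [← Finset.sum_mul, ← Finset.sum_mul]
  gcongr
  exact sum_rpow_le hb hb' n

/-- By concavity the worst spectrum has m eigenvalues equal to 1/m, hence the tangent line at 1/m.
-/
theorem tsum_div_add_le_of_card (hν : ∀ i, 0 < ν i) {m t : ℝ} (hm : 0 < m) (ht : 0 < t)
    (hcard : ∑' _ : κ, (1 : ℝ≥0∞) = ENNReal.ofReal m) (hsum : ∑' i, ENNReal.ofReal (ν i) ≤ 1) :
    ∑' i, ENNReal.ofReal (ν i / (t * ν i + 1)) ≤ ENNReal.ofReal (m / (t + m)) := by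
  have hpt : ∀ i, ν i / (t * ν i + 1) ≤ t * (1 / m) ^ 2 / (t * (1 / m) + 1) ^ 2 +
      1 / (t * (1 / m) + 1) ^ 2 * ν i := by
    intro i
    have hνi := hν i
    have h := div_add_le_tangent (x := t * ν i) (a := t * (1 / m)) (μ := 1) (by positivity)
      (by positivity) one_pos
    have h2 : ν i / (t * ν i + 1) = t⁻¹ * (t * ν i / (t * ν i + 1)) := by field_simp
    have h3 : t * (1 / m) ^ 2 / (t * (1 / m) + 1) ^ 2 + 1 / (t * (1 / m) + 1) ^ 2 * ν i =
        t⁻¹ * (((t * (1 / m)) ^ 2 + 1 * (t * ν i)) / (t * (1 / m) + 1) ^ 2) := by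
      field_simp
    rw [h2, h3]
    gcongr
  calc _ ≤ ∑' i, (ENNReal.ofReal (t * (1 / m) ^ 2 / (t * (1 / m) + 1) ^ 2) * 1 +
        ENNReal.ofReal (1 / (t * (1 / m) + 1) ^ 2) * ENNReal.ofReal (ν i)) := by
        refine ENNReal.tsum_le_tsum fun i => ?_
        have hνi := hν i
        rw [mul_one, ← ENNReal.ofReal_mul (by positivity),
          ← ENNReal.ofReal_add (by positivity) (by positivity)]
        exact ENNReal.ofReal_le_ofReal (hpt i)
    _ ≤ ENNReal.ofReal (t * (1 / m) ^ 2 / (t * (1 / m) + 1) ^ 2) * ENNReal.ofReal m +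
        ENNReal.ofReal (1 / (t * (1 / m) + 1) ^ 2) * 1 := by
        rw [ENNReal.tsum_add, ENNReal.tsum_mul_left, ENNReal.tsum_mul_left, hcard]
        gcongr
    _ = _ := by
        rw [mul_one, ← ENNReal.ofReal_mul (by positivity),
          ← ENNReal.ofReal_add (by positivity) (by positivity)]
        congr 1
        field_simp

theorem sum_tsum_le_of_card (hν : ∀ i, 0 < ν i) {m : ℝ} (hm : 0 < m)
    (hcard : ∑' _ : κ, (1 : ℝ≥0∞) = ENNReal.ofReal m) (hsum : ∑' i, ENNReal.ofReal (ν i) ≤ 1)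
    (n : ℕ) :
    ∑ k : Fin n, ∑' i, ENNReal.ofReal (ν i / ((k.val + 1 : ℕ) * ν i + 1)) ≤
      ENNReal.ofReal (m * Real.log (1 + n / m)) := by
  rw [Fin.sum_univ_eq_sum_range
    (fun k => ∑' i, ENNReal.ofReal (ν i / ((k + 1 : ℕ) * ν i + 1))) n]
  refine (Finset.sum_le_sum fun k _ =>
    tsum_div_add_le_of_card hν hm (by positivity) hcard hsum).trans ?_
  rw [← ENNReal.ofReal_sum_of_nonneg fun k _ => by positivity]
  exact ENNReal.ofReal_le_ofReal (sum_div_add_le_log hm n)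

end EffectiveDimension

/-! ### Excess risk rates -/

section ExcessRisk

variable {X : Type*} [TopologicalSpace X] [CompactSpace X] [MeasurableSpace X] [BorelSpace X]
  [SecondCountableTopology X] {K : C(X × X, ℝ)} {H : Type*} [NormedAddCommGroup H]
  [InnerProductSpace ℝ H] [CompleteSpace H] [RKHS ℝ H X ℝ] {n : ℕ} {ρ : Measure (X × ℝ)}
  [IsProbabilityMeasure ρ] {Y : ℝ}

-- By Parseval Σ e_i(x)² = ‖k_x‖² ≤ 1; integrate over x.
omit [CompactSpace X] [SecondCountableTopology X] in
theorem tsum_eigenvalues_le_one (hF : Continuous (feature H : X → H))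
    (hF1 : ∀ x, ‖feature H x‖ ≤ 1) (μ : Measure X) [IsProbabilityMeasure μ] {κ : Type*}
    [Countable κ] (e : HilbertBasis κ ℝ H) {ν : κ → ℝ} (hν : ∀ i, ∫ x, e i x ^ 2 ∂μ = ν i) :
    ∑' i, ENNReal.ofReal (ν i) ≤ 1 := by
  have hm : ∀ i, Measurable fun x => e i x ^ 2 := fun i =>
    ((continuous_rkhs hF (e i)).pow 2).measurable
  have hi : ∀ i, Integrable (fun x => e i x ^ 2) μ := fun i => by
    refine Integrable.of_bound (hm i).aestronglyMeasurable (‖e i‖ ^ 2)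
      (Filter.Eventually.of_forall fun x => ?_)
    rw [norm_pow]
    gcongr
    exact abs_apply_le_norm hF1 _ _
  calc ∑' i, ENNReal.ofReal (ν i) = ∑' i, ∫⁻ x, ENNReal.ofReal (e i x ^ 2) ∂μ := by
        refine tsum_congr fun i => ?_
        rw [← hν, ofReal_integral_eq_lintegral_ofReal (hi i)
          (Filter.Eventually.of_forall fun x => sq_nonneg _)]
    _ = ∫⁻ x, ∑' i, ENNReal.ofReal (e i x ^ 2) ∂μ :=
        (lintegral_tsum fun i => (hm i).ennreal_ofReal.aemeasurable).symm
    _ ≤ ∫⁻ _, 1 ∂μ := by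
        refine lintegral_mono fun x => ?_
        have h := e.hasSum_inner_mul_inner (feature H x) (feature H x)
        have h2 : ∀ i, ⟪feature H x, e i⟫_ℝ * ⟪e i, feature H x⟫_ℝ = e i x ^ 2 := fun i => by
          rw [real_inner_comm (feature H x), inner_feature, sq]
        simp_rw [h2] at h
        change ∑' i, ENNReal.ofReal (e i x ^ 2) ≤ 1
        rw [← ENNReal.ofReal_tsum_of_nonneg (fun i => sq_nonneg _) h.summable, h.tsum_eq,
          real_inner_self_eq_norm_sq, ← ENNReal.ofReal_one]
        exact ENNReal.ofReal_le_ofReal (pow_le_one₀ (norm_nonneg _) (hF1 x))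
    _ = 1 := by simp

theorem excessRiskLE_leverage (hS : Setting K H ρ Y) (hn : 1 ≤ n) {β lam : ℝ} (hβ : 0 < β)
    (hβ' : β ≤ 1 / 2) (hl : 0 < lam) {f g : Lp ℝ 2 ρ.fst} (hf : f =ᵐ[ρ.fst] regressionFunction ρ)
    (hfg : IsPowApply (integralOperator K ρ.fst) β g f) {κ : Type*} [Countable κ]
    (e : HilbertBasis κ ℝ H) {ν : κ → ℝ} (hν : ∀ i, ∫ x, e i x ^ 2 ∂ρ.fst = ν i) {Q : ℝ}
    (hQ0 : 0 ≤ Q) (hQ : ∑ k : Fin n, ∑' i, ENNReal.ofReal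
      (ν i / ((k.val + 1 : ℕ) * ν i + lam * n)) ≤ ENNReal.ofReal Q) :
    ExcessRiskLE H ρ Y lam n (lam ^ (2 * β) * ‖g‖ ^ 2 + 4 * Y ^ 2 * Q / n) := by
  have hF := continuous_feature hS.kernel_eq
  have hF1 := norm_feature_le hS.kernel_eq hS.kernel_le_one
  have hμ : 0 < lam * n := by positivity
  refine ⟨(integral_averageRisk hF hn hl hS.label_bounded).1, ?_⟩
  have h := excess_le_of_forall hS.kernel_eq hF1 hS.label_bounded hβ hβ' hl hf hfg zero_le_one
    (d := 4 * Y ^ 2 * Q / n) (B := ∫ S, averageRisk H ρ Y lam S ∂(Measure.pi fun _ : Fin n => ρ))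
    fun u => by
      rw [one_mul]
      exact integral_averageRisk_le_leverage hF hF1 hn hl hS.label_bounded hQ0
        ((Finset.sum_le_sum fun k _ => lintegral_leverage_le hF hF1 hμ e hν k).trans hQ) u
  linarith

/-- The factor 1 + 1/(λn) also multiplies the Bayes risk, which leaves the extra term R(f_ρ)/(λn).
-/
theorem excessRiskLE_mul (hS : Setting K H ρ Y) (hn : 1 ≤ n) {β lam : ℝ} (hβ : 0 < β)
    (hβ' : β ≤ 1 / 2) (hl : 0 < lam) {f g : Lp ℝ 2 ρ.fst} (hf : f =ᵐ[ρ.fst] regressionFunction ρ)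
    (hfg : IsPowApply (integralOperator K ρ.fst) β g f) :
    ExcessRiskLE H ρ Y lam n
      ((1 + 1 / (lam * n)) * (lam ^ (2 * β) * ‖g‖ ^ 2) + bayesRisk ρ / (lam * n)) := by
  have hF := continuous_feature hS.kernel_eq
  have hF1 := norm_feature_le hS.kernel_eq hS.kernel_le_one
  have hμ : 0 < lam * n := by positivity
  refine ⟨(integral_averageRisk hF hn hl hS.label_bounded).1, ?_⟩
  have h := excess_le_of_forall hS.kernel_eq hF1 hS.label_bounded hβ hβ' hl hf hfg
    (c := 1 + 1 / (lam * n)) (by positivity) (d := 0)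
    (B := ∫ S, averageRisk H ρ Y lam S ∂(Measure.pi fun _ : Fin n => ρ))
    fun u => by
      rw [add_zero]
      exact integral_averageRisk_le_mul hF hF1 hn hl hS.label_bounded u
  have h2 : (1 + 1 / (lam * n)) * bayesRisk ρ = bayesRisk ρ + bayesRisk ρ / (lam * n) := by ring
  linarith

omit [TopologicalSpace X] [CompactSpace X] [BorelSpace X] [SecondCountableTopology X]
  [CompleteSpace H] in
theorem ExcessRiskLE.mono {lam B B' : ℝ} (h : ExcessRiskLE H ρ Y lam n B) (hB : B ≤ B') :
    ExcessRiskLE H ρ Y lam n B' :=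
  ⟨h.1, h.2.trans hB⟩

/-- The rate under a bound on the trace of a power of the integral operator. -/
theorem excessRiskLE_rate (hS : Setting K H ρ Y) (hn : 1 ≤ n) {β b T G : ℝ} (hβ : 0 < β)
    (hβ' : β ≤ 1 / 2) (hb : 0 < b) (hb' : b ≤ 1) (hsrc : SourceCondition K ρ β G)
    (hT : tracePow (integralOperator K ρ.fst) b ≤ ENNReal.ofReal T) :
    ExcessRiskLE H ρ Y ((n : ℝ) ^ (-(1 / (2 * β + b)))) n
      ((G ^ 2 + 4 * Y ^ 2 * max T 0 / b) * (n : ℝ) ^ (-(2 * β / (2 * β + b)))) := by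
  obtain ⟨f, g, hf, hg, hfg⟩ := hsrc
  obtain ⟨κ, hκ, e, ν, hν0, hν, htr⟩ := exists_hilbertBasis_eigenvalues (H := H) ρ.fst
    hS.support_eq hS.kernel_eq (hT.trans_lt ENNReal.ofReal_lt_top).ne
  have hn' : (0 : ℝ) < n := by positivity
  -- This λ balances the approximation error λ^(2β) against the leverage term λ^(-b)/n.
  set lam := (n : ℝ) ^ (-(1 / (2 * β + b))) with hlam
  have hl : 0 < lam := by positivity
  have hμ : 0 < lam * n := by positivity
  have hT' : ∑' i, ENNReal.ofReal (ν i ^ b) ≤ ENNReal.ofReal (max T 0) := by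
    rw [← htr]
    exact hT.trans (ENNReal.ofReal_le_ofReal (le_max_left _ _))
  have h := excessRiskLE_leverage hS hn hβ hβ' hl hf hfg e hν (by positivity)
    (sum_tsum_le_of_tsum_rpow_le hν0 hb hb' hμ (le_max_right T 0) hT' n)
  refine h.mono ?_
  have h0 : 2 * β + b ≠ 0 := by positivity
  have h1 : lam ^ (2 * β) = (n : ℝ) ^ (-(2 * β / (2 * β + b))) := by
    rw [hlam, ← Real.rpow_mul hn'.le]
    congr 1
    ring
  have h2 : (n : ℝ) ^ b / b * (lam * n) ^ (-b) * max T 0 / n =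
      max T 0 / b * (n : ℝ) ^ (-(2 * β / (2 * β + b))) := by
    have h3 : (n : ℝ) ^ b * (lam * n) ^ (-b) / n = (n : ℝ) ^ (-(2 * β / (2 * β + b))) := by
      rw [Real.mul_rpow hl.le hn'.le, hlam, ← Real.rpow_mul hn'.le]
      nth_rewrite 4 [← Real.rpow_one (n : ℝ)]
      rw [← Real.rpow_add hn', ← Real.rpow_add hn', ← Real.rpow_sub hn']
      congr 1
      field_simp
      ring
    rw [← h3]
    ring
  have h4 : ‖g‖ ^ 2 ≤ G ^ 2 := by gcongr
  calc lam ^ (2 * β) * ‖g‖ ^ 2 + 4 * Y ^ 2 * ((n : ℝ) ^ b / b * (lam * n) ^ (-b) * max T 0) / n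
      = lam ^ (2 * β) * ‖g‖ ^ 2 +
        4 * Y ^ 2 * ((n : ℝ) ^ b / b * (lam * n) ^ (-b) * max T 0 / n) := by ring
    _ = (‖g‖ ^ 2 + 4 * Y ^ 2 * max T 0 / b) * (n : ℝ) ^ (-(2 * β / (2 * β + b))) := by
      rw [h1, h2]; ring
    _ ≤ _ := by gcongr

/-- The rate in terms of the Bayes risk. -/
theorem excessRiskLE_lowNoise (hS : Setting K H ρ Y) (hn : 1 ≤ n) {β G : ℝ} (hβ : 0 < β)
    (hβ' : β ≤ 1 / 2) (hsrc : SourceCondition K ρ β G) :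
    ExcessRiskLE H ρ Y (max (1 / (n : ℝ)) ((bayesRisk ρ / n) ^ (1 / (2 * β + 1)))) n
      ((2 * G ^ 2 + 1) *
        ((bayesRisk ρ / n) ^ (2 * β / (2 * β + 1)) + (n : ℝ) ^ (-(2 * β)))) := by
  obtain ⟨f, g, hf, hg, hfg⟩ := hsrc
  have hn' : (0 : ℝ) < n := by positivity
  have hR := bayesRisk_nonneg ρ
  set R := bayesRisk ρ with hRdef
  -- The value `w` balances λ^(2β) against R/(λn); the maximum with 1/n keeps λn ≥ 1, hence the
  -- prefactor at most 2.
  set w := (R / n) ^ (1 / (2 * β + 1)) with hw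
  have hw0 : 0 ≤ w := by positivity
  set lam := max (1 / (n : ℝ)) w with hlam
  have hl1 : 1 / (n : ℝ) ≤ lam := le_max_left _ _
  have hl2 : w ≤ lam := le_max_right _ _
  have hl : 0 < lam := lt_of_lt_of_le (by positivity) hl1
  refine (excessRiskLE_mul hS hn hβ hβ' hl hf hfg).mono ?_
  have hln : 1 ≤ lam * n := by rwa [div_le_iff₀ hn'] at hl1
  have h1 : 1 + 1 / (lam * n) ≤ 2 := by
    have : 1 / (lam * n) ≤ 1 := by rw [div_le_one (by positivity)]; exact hln
    linarith
  have h2 : lam ^ (2 * β) ≤ (R / n) ^ (2 * β / (2 * β + 1)) + (n : ℝ) ^ (-(2 * β)) := by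
    have e1 : w ^ (2 * β) = (R / n) ^ (2 * β / (2 * β + 1)) := by
      rw [hw, ← Real.rpow_mul (by positivity)]
      congr 1
      ring
    have e2 : (1 / (n : ℝ)) ^ (2 * β) = (n : ℝ) ^ (-(2 * β)) := by
      rw [one_div, Real.inv_rpow hn'.le, Real.rpow_neg hn'.le]
    rw [← e1, ← e2, hlam]
    rcases max_choice (1 / (n : ℝ)) w with h | h <;> rw [h]
    · exact le_add_of_nonneg_left (by positivity)
    · exact le_add_of_nonneg_right (by positivity)
  have h3 : R / (lam * n) ≤ (R / n) ^ (2 * β / (2 * β + 1)) := by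
    rcases hR.eq_or_lt with h | h
    · rw [← h]; simp only [zero_div]; positivity
    · have hRn : 0 < R / n := by positivity
      have hwpos : 0 < w := by positivity
      calc R / (lam * n) = (R / n) / lam := by field_simp
        _ ≤ (R / n) / w := by gcongr
        _ = (R / n) ^ (2 * β / (2 * β + 1)) := by
          nth_rewrite 1 [← Real.rpow_one (R / n)]
          rw [hw, ← Real.rpow_sub hRn]
          congr 1
          field_simp
          ring
  have h4 : ‖g‖ ^ 2 ≤ G ^ 2 := by gcongr
  have h5 : (0 : ℝ) ≤ (n : ℝ) ^ (-(2 * β)) := by positivity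
  calc (1 + 1 / (lam * n)) * (lam ^ (2 * β) * ‖g‖ ^ 2) + R / (lam * n)
      ≤ 2 * (((R / n) ^ (2 * β / (2 * β + 1)) + (n : ℝ) ^ (-(2 * β))) * G ^ 2) +
        (R / n) ^ (2 * β / (2 * β + 1)) := by gcongr
    _ ≤ _ := by nlinarith

/-- The rate for an integral operator of finite rank. -/
theorem excessRiskLE_finiteRank (hS : Setting K H ρ Y) (hn : 1 ≤ n) {G : ℝ}
    (hsrc : SourceCondition K ρ (1 / 2) G)
    (hT : tracePow (integralOperator K ρ.fst) 0 < ⊤) :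
    ExcessRiskLE H ρ Y (1 / (n : ℝ)) n ((2 * G ^ 2 + 4 * Y ^ 2) *
      ((n : ℝ)⁻¹ * (tracePow (integralOperator K ρ.fst) 0).toReal *
        Real.log (1 + n / (tracePow (integralOperator K ρ.fst) 0).toReal))) := by
  obtain ⟨f, g, hf, hg, hfg⟩ := hsrc
  obtain ⟨κ, hκ, e, ν, hν0, hν, htr⟩ := exists_hilbertBasis_eigenvalues (H := H) ρ.fst
    hS.support_eq hS.kernel_eq hT.ne
  have hn' : (0 : ℝ) < n := by positivity
  have hl : 0 < 1 / (n : ℝ) := by positivity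
  have hln : 1 / (n : ℝ) * n = 1 := by field_simp
  have hF := continuous_feature hS.kernel_eq
  have hF1 := norm_feature_le hS.kernel_eq hS.kernel_le_one
  have htr0 := htr 0
  simp only [Real.rpow_zero, ENNReal.ofReal_one] at htr0
  rcases isEmpty_or_nonempty κ with hκe | ⟨⟨i₀⟩⟩
  · have hz : tracePow (integralOperator K ρ.fst) 0 = 0 := by rw [htr0]; simp
    have h := excessRiskLE_leverage hS hn (by norm_num) le_rfl hl hf
      (isPowApply_zero_of_tracePow_eq_zero hz hfg) e hν le_rfl (by simp)
    refine h.mono ?_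
    simp [hz]
  · set m := (tracePow (integralOperator K ρ.fst) 0).toReal with hm
    have hcard : ∑' _ : κ, (1 : ℝ≥0∞) = ENNReal.ofReal m := by
      rw [← htr0, hm, ENNReal.ofReal_toReal hT.ne]
    have hm1 : 1 ≤ m := by
      have h1 : (1 : ℝ≥0∞) ≤ ENNReal.ofReal m := hcard ▸ ENNReal.le_tsum i₀
      rwa [ENNReal.one_le_ofReal] at h1
    have hm0 : 0 < m := by linarith
    -- The approximation error G²/n has no logarithm. Since log(1 + 1/m) ≥ 1/(m + 1) ≥ 1/(2m), it is
    -- absorbed with the factor 2 of 2G².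
    have hlog : 1 / 2 ≤ m * Real.log (1 + n / m) := by
      have h1 : 1 + 1 / m ≤ 1 + n / m := by
        gcongr
        exact_mod_cast hn
      have h2 : Real.log (1 + 1 / m) ≤ Real.log (1 + n / m) := Real.log_le_log (by positivity) h1
      have h3 : Real.log (m / (m + 1)) ≤ m / (m + 1) - 1 :=
        Real.log_le_sub_one_of_pos (by positivity)
      have h4 : Real.log (m / (m + 1)) = -Real.log (1 + 1 / m) := by
        rw [← Real.log_inv]
        congr 1
        field_simp
      have h5 : m / (m + 1) - 1 = -(1 / (m + 1)) := by
        field_simp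
        ring
      have h6 : 1 / (m + 1) ≤ Real.log (1 + n / m) := by linarith
      calc 1 / 2 ≤ m * (1 / (m + 1)) := by
            rw [mul_one_div, div_le_div_iff₀ two_pos (by positivity)]
            linarith
        _ ≤ _ := by gcongr
    have h := excessRiskLE_leverage hS hn (by norm_num) le_rfl hl hf hfg e hν
      (Q := m * Real.log (1 + n / m)) (by linarith) (by
        rw [hln]
        exact sum_tsum_le_of_card hν0 hm0 hcard
          (tsum_eigenvalues_le_one hF hF1 ρ.fst e hν) n)
    refine h.mono ?_
    have h4 : ‖g‖ ^ 2 ≤ G ^ 2 := by gcongr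
    have h5 : (1 / (n : ℝ)) ^ (2 * (1 / 2 : ℝ)) = (n : ℝ)⁻¹ := by
      norm_num
    rw [h5]
    calc (n : ℝ)⁻¹ * ‖g‖ ^ 2 + 4 * Y ^ 2 * (m * Real.log (1 + n / m)) / n
        ≤ (n : ℝ)⁻¹ * (G ^ 2 * (2 * (m * Real.log (1 + n / m)))) +
          4 * Y ^ 2 * (m * Real.log (1 + n / m)) / n := by
          gcongr
          nlinarith [sq_nonneg G]
      _ = _ := by ring

end ExcessRisk

end KTR3

/-! ### Choice of the regularization parameter -/

theorem corollary1 :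
    (∀ β b Y T G : ℝ, 0 < β → β ≤ 1 / 2 → 0 < b → b ≤ 1 →
      ∃ (C : ℝ) (lam : ℕ → ℝ → ℝ), (∀ n r, 0 ≤ lam n r) ∧
        ∀ (d : ℕ) (X : Set (EuclideanSpace ℝ (Fin d))) [CompactSpace X] (K : C(X × X, ℝ))
          (H : Type u) [NormedAddCommGroup H] [InnerProductSpace ℝ H] [CompleteSpace H]
          [RKHS ℝ H X ℝ] (ρ : MeasureTheory.Measure (X × ℝ)) [MeasureTheory.IsProbabilityMeasure ρ],
          KTR3.Setting K H ρ Y →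
          KTR3.SourceCondition K ρ β G →
          KTR3.tracePow (KTR3.integralOperator K ρ.fst) b ≤ ENNReal.ofReal T →
          ∀ n : ℕ, 1 ≤ n →
            KTR3.ExcessRiskLE H ρ Y (lam n (KTR3.bayesRisk ρ)) n
              (C * min ((KTR3.bayesRisk ρ / n) ^ (2 * β / (2 * β + 1)) + (n : ℝ) ^ (-(2 * β)))
                ((n : ℝ) ^ (-(2 * β / (2 * β + b)))))) ∧
    (∀ Y G : ℝ,
      ∃ (C : ℝ) (lam : ℕ → ℝ), (∀ n, 0 ≤ lam n) ∧
        ∀ (d : ℕ) (X : Set (EuclideanSpace ℝ (Fin d))) [CompactSpace X] (K : C(X × X, ℝ))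
          (H : Type u) [NormedAddCommGroup H] [InnerProductSpace ℝ H] [CompleteSpace H]
          [RKHS ℝ H X ℝ] (ρ : MeasureTheory.Measure (X × ℝ)) [MeasureTheory.IsProbabilityMeasure ρ],
          KTR3.Setting K H ρ Y →
          KTR3.SourceCondition K ρ (1 / 2) G →
          KTR3.tracePow (KTR3.integralOperator K ρ.fst) 0 < ⊤ →
          ∀ n : ℕ, 1 ≤ n →
            KTR3.ExcessRiskLE H ρ Y (lam n) n
              (C * ((n : ℝ)⁻¹ * (KTR3.tracePow (KTR3.integralOperator K ρ.fst) 0).toReal *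
                Real.log (1 + n / (KTR3.tracePow (KTR3.integralOperator K ρ.fst) 0).toReal)))) := by
  refine ⟨fun β b Y T G hβ hβ' hb hb' => ?_, fun Y G => ?_⟩
  -- Both rates are explicit in n and the Bayes risk, so λ can be the one tuned for the smaller
  -- rate; the constant is the sum of the two constants.
  · refine ⟨(2 * G ^ 2 + 1) + (G ^ 2 + 4 * Y ^ 2 * max T 0 / b), fun n r =>
      if (r / n) ^ (2 * β / (2 * β + 1)) + (n : ℝ) ^ (-(2 * β)) ≤
        (n : ℝ) ^ (-(2 * β / (2 * β + b))) then
        max (1 / (n : ℝ)) ((r / n) ^ (1 / (2 * β + 1)))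
      else (n : ℝ) ^ (-(1 / (2 * β + b))), fun n r => ?_, ?_⟩
    · dsimp only
      split_ifs
      · exact le_max_of_le_left (by positivity)
      · positivity
    · intro d X _ K H _ _ _ _ ρ _ hS hsrc hT n hn
      have hR := KTR3.bayesRisk_nonneg ρ
      have hC : 0 ≤ G ^ 2 + 4 * Y ^ 2 * max T 0 / b := by positivity
      dsimp only
      split_ifs with h
      · rw [min_eq_left h]
        exact (KTR3.excessRiskLE_lowNoise hS hn hβ hβ' hsrc).mono
          (mul_le_mul_of_nonneg_right (by linarith) (by positivity))
      · rw [min_eq_right (not_le.1 h).le]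
        exact (KTR3.excessRiskLE_rate hS hn hβ hβ' hb hb' hsrc hT).mono
          (mul_le_mul_of_nonneg_right (by nlinarith [sq_nonneg G]) (by positivity))
  · exact ⟨2 * G ^ 2 + 4 * Y ^ 2, fun n => 1 / (n : ℝ), fun n => by positivity,
      fun d X _ K H _ _ _ _ ρ _ hS hsrc hT n hn =>
        KTR3.excessRiskLE_finiteRank hS hn hsrc hT⟩
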